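/- Let $\mathcal A$ be a finite alphabet. A factor of a finite word or of an infinite sequence $\mathbf u=u_0u_1u_2\cdots$ over $\mathcal A$ is a finite word (possibly empty) occurring contiguously in it. A finite word $w$ is rich if it has exactly $|w|+1$ distinct palindromic factors (the empty word included), which is the maximum possible number; a sequence is rich if each of its factors is rich. The exponent of a non-empty finite word $z$ is $|z|/q$, where $q$ is the minimum length of a non-empty word $v$ such that $z$ is a prefix of $v^\omega=vvv\cdots$. The critical exponent $E(\mathbf u)\in[1,+\infty]$ of a sequence $\mathbf u$ is the supremum of the exponents of its non-empty factors. For $d\in\mathbb N$ let $\mathcal C_d$ be the class of $d$-ary rich sequences, i.e. of all rich infinite sequences over an alphabet of $d$ letters, and let $$\mathrm{RT}(\mathcal C_d)=\inf\{E(\mathbf u):\mathbf u\in\mathcal C_d\}$$ be its repetition threshold. Then the limit of $\mathrm{RT}(\mathcal C_d)$ as $d\to\infty$ exists and $$\lim_{d\to\infty}\mathrm{RT}(\mathcal C_d)=2 .$$ -/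

import Mathlib

open Filter
open scoped Topology NNReal ENNReal

namespace RichSeq

/-- The factor `u_j u_{j+1} ⋯ u_{j+n-1}` of the sequence `u`. -/
def block {α : Type*} (u : ℕ → α) (j n : ℕ) : List α :=
  List.ofFn fun i : Fin n => u (j + i)

/-- The language of a sequence: the set of all its (finite) factors. -/
def language {α : Type*} (u : ℕ → α) : Set (List α) :=
  {v | ∃ j n : ℕ, v = block u j n}

/-- The palindromic factors of a word, the empty word included. -/
def palFactors {α : Type*} (w : List α) : Set (List α) :=
  {p | p <:+: w ∧ p.Palindrome}

theorem palFactors_finite {α : Type*} (w : List α) : (palFactors w).Finite := by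
  refine (w.sublists.finite_toSet).subset ?_
  rintro p ⟨hp, -⟩
  exact List.mem_sublists.2 hp.sublist

/-- A word `w` is rich if it has `|w| + 1` distinct palindromic factors (the maximum). -/
def RichWord {α : Type*} (w : List α) : Prop :=
  (palFactors w).ncard = w.length + 1

/-- A sequence is rich if each of its factors is rich. -/
def Rich {α : Type*} (u : ℕ → α) : Prop :=
  ∀ w ∈ language u, RichWord w

/-- The infinite power `v^ω = v v v ⋯` of a non-empty word `v`. -/
def omegaPower {α : Type*} (v : List α) (hv : v ≠ []) : ℕ → α :=
  fun i => v[i % v.length]'(Nat.mod_lt _ (List.length_pos_of_ne_nil hv))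

/-- The lengths of the non-empty words `v` such that `z` is a prefix of `v^ω`. -/
def rootLengths {α : Type*} (z : List α) : Set ℕ :=
  {q | ∃ (v : List α) (hv : v ≠ []), v.length = q ∧ z = block (omegaPower v hv) 0 z.length}

theorem length_mem_rootLengths {α : Type*} {z : List α} (hz : z ≠ []) :
    z.length ∈ rootLengths z := by
  refine ⟨z, hz, rfl, ?_⟩
  refine List.ext_getElem (by simp [block]) ?_
  intro i h1 h2
  simp [block, omegaPower, Nat.mod_eq_of_lt h1]

/-- The exponent of a non-empty word `z`: the quotient `|z| / q`, where `q` is the minimum length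
of a non-empty word `v` such that `z` is a prefix of `v^ω`. -/
noncomputable def exponent {α : Type*} (z : List α) : ℝ≥0 :=
  (z.length : ℝ≥0) / ((sInf (rootLengths z) : ℕ) : ℝ≥0)

/-- The critical exponent of a sequence: the supremum, in `[0, ∞]`, of the exponents of its
non-empty factors. -/
noncomputable def criticalExponent {α : Type*} (u : ℕ → α) : ℝ≥0∞ :=
  ⨆ z ∈ {z | z ∈ language u ∧ z ≠ []}, (exponent z : ℝ≥0∞)

/-- The repetition threshold of a class of sequences: the infimum, in `[0, ∞]`, of their critical
exponents. -/
noncomputable def repetitionThreshold {α : Type*} (C : Set (ℕ → α)) : ℝ≥0∞ :=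
  ⨅ u ∈ C, criticalExponent u

/-- The class of `d`-ary rich sequences, that is, of the rich sequences over an alphabet of
size `d`. -/
def richClass (d : ℕ) : Set (ℕ → Fin d) :=
  {u | Rich u}

end RichSeq

/-! Lower bound: a square-free rich word over d letters has bounded length, so a rich sequence over
a finite alphabet contains a square and has critical exponent at least 2. A palindrome in such a
word has odd length, and its central letter c cannot recur in its half: the complete return to c
would be a palindrome, and its mirror copy on the other side of the centre would produce a square.
The half therefore uses at most d - 1 letters. By induction palindromes have bounded length, so
there are boundedly many, and a rich word is shorter than its number of palindromes
(`exists_bound_squareFree_rich`).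

Upper bound: write φ for `expand k [k]` and ψ for `expand k K` with K = `mountain k m`. The sequence
is the ψ-image of the fixed point of φ, over k + m + 1 letters. The letter 0 occurs exactly once in
the image of each letter, at its start, so factors can be decoded; the only ambiguity is between k -
1 and k, whose images are 0K and 0KK.

Richness follows once all complete returns to palindromes are palindromes
(`PalindromicReturns.richWord`). This is proved by decoding to shorter words
(`Marker.returnPalindrome_image`); the ambiguity is handled by `extension_hub` and
`palindrome_of_lt`.

Repetitions are decoded as well (`Marker.descent`). One step loses at most a single 0, unless k - 1
and k are confused at an end; this costs up to two more copies of K, but forces a long period. With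
|K| = q + 1 and q² = 2^k, at every level 0 weighs at most 1/q of what k weighs, and a confusion
requires a period at least q times the weight of k (`letterWeight_bounds`). Summed over all levels
the losses leave exponents at most 2 + 9/q (`repetition_bound`), and q is arbitrarily large. -/

namespace RichSeq

/-! ### Palindromic factors, rich words and complete returns -/

section Palindromes

variable {α : Type*}

theorem mem_palFactors {p w : List α} : p ∈ palFactors w ↔ p <:+: w ∧ p.reverse = p := by
  simp [palFactors, List.Palindrome.iff_reverse_eq]

/-- Every palindromic suffix which is shorter than some palindromic suffix occurs earlier. -/
theorem palindromic_suffix_infix {w p q : List α} {a : α} (hp : p <:+ w ++ [a])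
    (hp' : p.reverse = p) (hq : q <:+ w ++ [a]) (hq' : q.reverse = q)
    (hlt : q.length < p.length) : q <:+: w := by
  have hqp : q <:+ p := List.suffix_of_suffix_length_le hq hp hlt.le
  have hpre : q <+: p := by
    have := List.reverse_prefix.2 hqp
    rwa [hp', hq'] at this
  obtain ⟨z, rfl⟩ := hpre
  have hz : z ≠ [] := by rintro rfl; simp at hlt
  obtain ⟨x, hx⟩ := hp
  obtain ⟨z', b, rfl⟩ := List.eq_nil_or_concat' z |>.resolve_left hz
  have : (x ++ q ++ z') ++ [b] = w ++ [a] := by rw [← hx]; simp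
  obtain ⟨h, -⟩ := List.append_inj' this rfl
  exact ⟨x, z', h⟩

theorem infix_concat_iff' {p w : List α} {a : α} :
    p <:+: w ++ [a] ↔ p <:+ w ++ [a] ∨ p <:+: w := by
  rw [List.infix_concat_iff]

/-- Of two new palindromic suffixes, the shorter one is also a prefix of the longer one, hence
already occurs in `w`. -/
theorem ncard_palFactors_concat_le (w : List α) (a : α) :
    (palFactors (w ++ [a])).ncard ≤ (palFactors w).ncard + 1 := by
  by_cases h : ∃ p, p ∈ palFactors (w ++ [a]) ∧ p ∉ palFactors w
  · obtain ⟨p, hp, hpn⟩ := h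
    refine (Set.ncard_le_ncard (t := insert p (palFactors w)) ?_
      ((palFactors_finite w).insert p)).trans (Set.ncard_insert_le _ _)
    intro q hq
    by_contra hqn
    rw [Set.mem_insert_iff, not_or] at hqn
    rw [mem_palFactors] at hp hpn hq
    have h1 := (infix_concat_iff'.1 hp.1).resolve_right fun h => hpn ⟨h, hp.2⟩
    have h2 := (infix_concat_iff'.1 hq.1).resolve_right
      fun h => hqn.2 (mem_palFactors.2 ⟨h, hq.2⟩)
    rcases lt_trichotomy q.length p.length with hl | hl | hl
    · exact hqn.2 (mem_palFactors.2 ⟨palindromic_suffix_infix h1 hp.2 h2 hq.2 hl, hq.2⟩)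
    · exact hqn.1 ((List.suffix_of_suffix_length_le h2 h1 hl.le).eq_of_length hl)
    · exact hpn ⟨palindromic_suffix_infix h2 hq.2 h1 hp.2 hl, hp.2⟩
  · push Not at h
    exact (Set.ncard_le_ncard (fun p hp => h p hp) (palFactors_finite w)).trans (Nat.le_succ _)

theorem palFactors_reverse (w : List α) : palFactors w.reverse = palFactors w := by
  ext p
  rw [mem_palFactors, mem_palFactors]
  constructor
  · rintro ⟨h, h'⟩
    refine ⟨?_, h'⟩
    have := List.reverse_infix.2 h
    rwa [h', List.reverse_reverse] at this
  · rintro ⟨h, h'⟩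
    refine ⟨?_, h'⟩
    have := List.reverse_infix.2 h
    rwa [h'] at this

theorem ncard_palFactors_append_le (w x : List α) :
    (palFactors (w ++ x)).ncard ≤ (palFactors w).ncard + x.length := by
  induction x using List.reverseRecOn with
  | nil => simp
  | append_singleton x a ih =>
    rw [← List.append_assoc]
    have := ncard_palFactors_concat_le (w ++ x) a
    simp only [List.length_append, List.length_singleton]
    omega

theorem palFactors_nil : palFactors ([] : List α) = {[]} := by
  ext p
  rw [mem_palFactors]
  simp
  rintro rfl
  rfl

theorem ncard_palFactors_le (w : List α) : (palFactors w).ncard ≤ w.length + 1 := by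
  have := ncard_palFactors_append_le [] w
  rw [palFactors_nil, Set.ncard_singleton, List.nil_append] at this
  omega

/-- A letter added on either side brings at most one new palindrome, so a shortage in a factor could
never be made up. -/
theorem RichWord.infix {w w' : List α} (h : RichWord w) (hw : w' <:+: w) : RichWord w' := by
  obtain ⟨x, y, rfl⟩ := hw
  unfold RichWord at *
  have h1 := ncard_palFactors_append_le (x ++ w') y
  have h2 := ncard_palFactors_append_le w'.reverse x.reverse
  rw [← List.reverse_append, palFactors_reverse, palFactors_reverse] at h2
  have h3 := ncard_palFactors_le w'
  simp only [List.length_append, List.length_reverse] at *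
  omega

/-- In a rich word, the complete returns to a letter are palindromes. -/
theorem RichWord.return_palindrome {c : α} {x : List α}
    (h : RichWord (c :: (x ++ [c]))) (hx : c ∉ x) : x.reverse = x := by
  have h1 : RichWord (c :: x) := h.infix ⟨[], [c], by simp⟩
  unfold RichWord at *
  -- The final `c` must create a new palindromic suffix `p`. It begins with `c` and is not `[c]`,
  -- so, `c` being absent from `x`, it is the whole word.
  have : ∃ p, p ∈ palFactors (c :: (x ++ [c])) ∧ p ∉ palFactors (c :: x) := by
    by_contra hcon
    push Not at hcon
    have := Set.ncard_le_ncard (fun p hp => hcon p hp) (palFactors_finite (c :: x))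
    simp only [List.length_cons, List.length_append] at *
    omega
  obtain ⟨p, hp, hpn⟩ := this
  rw [mem_palFactors] at hp hpn
  have hs : p <:+ (c :: x) ++ [c] :=
    (infix_concat_iff'.1 (by simpa using hp.1)).resolve_right fun h => hpn ⟨h, hp.2⟩
  obtain ⟨y, hy⟩ := hs
  rcases List.eq_nil_or_concat' p with rfl | ⟨p', b, rfl⟩
  · exact absurd ⟨List.nil_infix, rfl⟩ hpn
  rw [← List.append_assoc] at hy
  obtain ⟨hy1, hb⟩ := List.append_inj' hy rfl
  simp only [List.cons.injEq, and_true] at hb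
  subst hb
  have hrev := hp.2
  rw [List.reverse_append] at hrev
  rcases p' with _ | ⟨e, p''⟩
  · exact absurd ⟨⟨[], x, by simp⟩, rfl⟩ hpn
  have hrev' : b = e ∧ p''.reverse = p'' ∧ e = b := by simpa using hrev
  have hce : b = e := hrev'.1
  subst hce
  rcases y with _ | ⟨f, y'⟩
  · simp only [List.nil_append, List.cons.injEq, true_and] at hy1
    rw [← hy1]
    exact hrev'.2.1
  · simp only [List.cons_append, List.cons.injEq] at hy1
    exact absurd (by rw [← hy1.2]; simp) hx

/-- If `R` is a complete return to a palindrome, then `R` is a palindrome. -/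
def ReturnPalindrome (R : List α) : Prop :=
  ∀ P : List α, P ≠ [] → P.reverse = P → P <+: R → P <:+ R → P ≠ R →
    (∀ x y, R = x ++ P ++ y → x = [] ∨ y = []) → R.reverse = R

/-- The complete returns to the palindromes in `w` are palindromes. -/
def PalindromicReturns (w : List α) : Prop :=
  ∀ R : List α, R <:+: w → ReturnPalindrome R

theorem PalindromicReturns.infix {w w' : List α} (h : PalindromicReturns w) (hw : w' <:+: w) :
    PalindromicReturns w' :=
  fun R hR => h R (hR.trans hw)

theorem exists_longest_palindromic_suffix (w : List α) :
    ∃ p, p <:+ w ∧ p.reverse = p ∧ ∀ q, q <:+ w → q.reverse = q → q.length ≤ p.length := by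
  classical
  have hfin : {p | p <:+ w ∧ p.reverse = p}.Finite :=
    (palFactors_finite w).subset fun p hp => mem_palFactors.2 ⟨hp.1.isInfix, hp.2⟩
  obtain ⟨p, hp, hmax⟩ := hfin.exists_maximalFor List.length _ ⟨[], List.nil_suffix, rfl⟩
  refine ⟨p, hp.1, hp.2, fun q hq hq' => ?_⟩
  rcases le_total q.length p.length with h | h
  · exact h
  · exact hmax ⟨hq, hq'⟩ h

/-- Each new letter contributes a palindrome: the longest palindromic suffix `Q` has no earlier
occurrence. -/
theorem PalindromicReturns.richWord {w : List α} (h : PalindromicReturns w) : RichWord w := by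
  induction w using List.reverseRecOn with
  | nil => simp [RichWord, palFactors_nil]
  | append_singleton w a ih =>
    have ihw := ih (h.infix ⟨[], [a], by simp⟩)
    obtain ⟨Q, hQ, hQ', hmax⟩ := exists_longest_palindromic_suffix (w ++ [a])
    have hQne : Q ≠ [] := by
      rintro rfl
      have := hmax [a] ⟨w, rfl⟩ rfl
      simp at this
    have hnew : ¬ Q <:+: w := by
      rintro ⟨x0, y0, hxy⟩
      classical
      -- Minimising `|y|` selects the last occurrence of `Q` before the final one. From there to the
      -- end is a complete return to `Q`, hence a palindromic suffix longer than `Q`.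
      have hex : ∃ n, ∃ x y, w ++ [a] = x ++ Q ++ y ∧ y ≠ [] ∧ y.length = n :=
        ⟨_, x0, y0 ++ [a], by rw [← hxy]; simp, by simp, rfl⟩
      obtain ⟨x, y, hw, hy, hlen⟩ := Nat.find_spec hex
      have hR : Q ++ y <:+ w ++ [a] := ⟨x, by rw [hw]; simp⟩
      have hrev := h (Q ++ y) hR.isInfix Q hQne hQ' (List.prefix_append _ _)
        (List.suffix_of_suffix_length_le hQ hR (by simp)) (by simpa using hy) ?_
      · have := hmax _ hR hrev
        simp only [List.length_append] at this
        exact hy (List.eq_nil_of_length_eq_zero (by omega))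
      · intro x' y' he
        by_contra hcon
        push Not at hcon
        have := Nat.find_min hex (m := y'.length) (by
          rw [← hlen]
          have := congrArg List.length he
          have := List.length_pos_of_ne_nil hcon.1
          simp only [List.length_append] at *
          omega)
        exact this ⟨x ++ x', y', by rw [hw, List.append_assoc, he]; simp, hcon.2, rfl⟩
    have hset : palFactors (w ++ [a]) = insert Q (palFactors w) := by
      ext p
      rw [Set.mem_insert_iff, mem_palFactors, mem_palFactors, infix_concat_iff']
      constructor
      · rintro ⟨hp | hp, hp'⟩
        · rcases (hmax p hp hp').lt_or_eq with hl | hl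
          · exact Or.inr ⟨palindromic_suffix_infix hQ hQ' hp hp' hl, hp'⟩
          · exact Or.inl ((List.suffix_of_suffix_length_le hp hQ hl.le).eq_of_length hl)
        · exact Or.inr ⟨hp, hp'⟩
      · rintro (rfl | ⟨hp, hp'⟩)
        · exact ⟨Or.inl hQ, hQ'⟩
        · exact ⟨Or.inr hp, hp'⟩
    unfold RichWord at *
    rw [hset, Set.ncard_insert_of_notMem (fun hc => hnew (mem_palFactors.1 hc).1)
      (palFactors_finite w), ihw]
    simp

end Palindromes

/-! ### Lower bound: rich sequences contain squares -/

section Squares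

variable {α : Type*}

theorem eq_block_of_infix {u : ℕ → α} {j n : ℕ} {x z y : List α} (h : x ++ z ++ y = block u j n) :
    z = block u (j + x.length) z.length := by
  refine List.ext_getElem (by simp [block]) fun i h1 h2 => ?_
  have hlen := congrArg List.length h
  simp only [block, List.length_append, List.length_ofFn] at hlen
  have h3 : (x ++ z ++ y)[x.length + i]'(by simp; omega) = z[i] := by
    simp [h1]
  rw [← h3]
  simp [h, block, add_assoc]

theorem mem_language_of_infix {u : ℕ → α} {w z : List α} (hw : w ∈ language u) (h : z <:+: w) :
    z ∈ language u := by
  obtain ⟨j, n, rfl⟩ := hw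
  obtain ⟨x, y, hxy⟩ := h
  exact ⟨_, _, eq_block_of_infix hxy⟩

/-- A word is square-free if it has no factor `vv` with `v` non-empty. -/
def SquareFree (w : List α) : Prop :=
  ∀ v : List α, v ≠ [] → ¬ v ++ v <:+: w

theorem SquareFree.infix {w w' : List α} (h : SquareFree w) (hw : w' <:+: w) : SquareFree w' :=
  fun v hv hvv => h v hv (hvv.trans hw)

theorem palindrome_cases {p : List α} (hp : p.Palindrome) :
    p = [] ∨ (∃ h c, p = h ++ [c] ++ h.reverse) ∨ ∃ h c, p = h ++ [c, c] ++ h.reverse := by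
  induction hp with
  | nil => exact Or.inl rfl
  | singleton c => exact Or.inr (Or.inl ⟨[], c, rfl⟩)
  | cons_concat a _ ih =>
    rcases ih with rfl | ⟨h, c, rfl⟩ | ⟨h, c, rfl⟩
    · exact Or.inr (Or.inr ⟨[], a, rfl⟩)
    · exact Or.inr (Or.inl ⟨a :: h, c, by simp⟩)
    · exact Or.inr (Or.inr ⟨a :: h, c, by simp⟩)

/-- If s is the gap from the centre to the next c, then s is a palindrome by richness, so the left
half ends in c s as well and (c s)(c s) is a square. -/
theorem SquareFree.palindrome_center {w h : List α} {c : α} (hsf : SquareFree w)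
    (hr : RichWord w) (hQ : h ++ [c] ++ h.reverse <:+: w) : c ∉ h := by
  intro hc
  obtain ⟨s, t, hst, hcs⟩ := List.eq_append_cons_of_mem (List.mem_reverse.2 hc)
  have hh : h = t.reverse ++ c :: s.reverse := by
    rw [← List.reverse_reverse h, hst]; simp
  have h1 : c :: (s ++ [c]) <:+: w :=
    List.IsInfix.trans ⟨h, t, by rw [hst]; simp⟩ hQ
  have h2 := (hr.infix h1).return_palindrome hcs
  refine hsf (c :: s) (by simp) (List.IsInfix.trans ⟨t.reverse, c :: t, ?_⟩ hQ)
  rw [hst, hh, h2]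
  simp

theorem exists_bound_squareFree_rich [Finite α] (d : ℕ) :
    ∃ B : ℕ, ∀ s : Finset α, s.card ≤ d → ∀ w : List α, (∀ x ∈ w, x ∈ s) → RichWord w →
      SquareFree w → w.length ≤ B := by
  classical
  induction d with
  | zero =>
    refine ⟨0, fun s hs w hw _ _ => ?_⟩
    rw [Nat.le_zero, Finset.card_eq_zero] at hs
    subst hs
    rw [List.eq_nil_iff_forall_not_mem.2 fun x hx => absurd (hw x hx) (by simp)]
    simp
  | succ d ih =>
    obtain ⟨M, hM⟩ := ih
    have hfin : {l : List α | l.length ≤ 2 * M + 1}.Finite := List.finite_length_le α (2 * M + 1)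
    refine ⟨{l : List α | l.length ≤ 2 * M + 1}.ncard, fun s hs w hw hr hsf => ?_⟩
    -- The half of an odd palindrome avoids its centre, so the bound `M` for one letter fewer
    -- applies to it; even palindromes contain a square of a letter.
    have hsub : palFactors w ⊆ {l : List α | l.length ≤ 2 * M + 1} := by
      rintro p ⟨hp, hpal⟩
      rcases palindrome_cases hpal with rfl | ⟨h, c, rfl⟩ | ⟨h, c, rfl⟩
      · simp
      · have hhw : h <:+: w := List.IsInfix.trans ⟨[], [c] ++ h.reverse, by simp⟩ hp
        have hcs : c ∈ s := hw c (hp.subset (by simp))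
        have hch := hsf.palindrome_center hr hp
        have := hM (s.erase c) (by rw [Finset.card_erase_of_mem hcs]; omega) h
          (fun x hx => Finset.mem_erase.2
            ⟨fun hxc => hch (hxc ▸ hx), hw x (hhw.subset hx)⟩) (hr.infix hhw) (hsf.infix hhw)
        simp only [Set.mem_ofPred_eq, List.length_append, List.length_singleton,
          List.length_reverse]
        omega
      · exact absurd (List.IsInfix.trans ⟨h, h.reverse, by simp⟩ hp) (hsf [c] (by simp))
    have := Set.ncard_le_ncard hsub hfin
    rw [hr] at this
    omega

theorem pos_of_mem_rootLengths {z : List α} {q : ℕ} (h : q ∈ rootLengths z) : 0 < q := by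
  obtain ⟨v, hv, rfl, -⟩ := h
  exact List.length_pos_of_ne_nil hv

theorem two_le_exponent_square {v : List α} (hv : v ≠ []) : 2 ≤ exponent (v ++ v) := by
  have hpos := List.length_pos_of_ne_nil hv
  have hmem : v.length ∈ rootLengths (v ++ v) := by
    refine ⟨v, hv, rfl, List.ext_getElem (by simp [block]) fun i h1 h2 => ?_⟩
    simp only [block, omegaPower, List.getElem_ofFn, zero_add]
    rw [List.length_append] at h1
    rw [List.getElem_append]
    split_ifs with h
    · simp [Nat.mod_eq_of_lt h]
    · congr 1
      rw [Nat.mod_eq_sub_mod (by omega), Nat.mod_eq_of_lt (by omega)]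
  have hle : sInf (rootLengths (v ++ v)) ≤ v.length := Nat.sInf_le hmem
  have hp := pos_of_mem_rootLengths (Nat.sInf_mem ⟨_, hmem⟩)
  rw [exponent, le_div_iff₀ (by exact_mod_cast hp), List.length_append]
  have : 2 * sInf (rootLengths (v ++ v)) ≤ v.length + v.length := by omega
  exact_mod_cast this

/-- The critical exponent of a rich sequence over a finite alphabet is at least two. -/
theorem Rich.two_le_criticalExponent [Finite α] {u : ℕ → α} (hu : Rich u) :
    2 ≤ criticalExponent u := by
  classical
  have := Fintype.ofFinite α
  obtain ⟨B, hB⟩ := exists_bound_squareFree_rich (α := α) (Fintype.card α)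
  have hw : block u 0 (B + 1) ∈ language u := ⟨0, B + 1, rfl⟩
  have hns : ¬ SquareFree (block u 0 (B + 1)) := fun hsf => by
    have := hB Finset.univ le_rfl _ (by simp) (hu _ hw) hsf
    simp [block] at this
  unfold SquareFree at hns
  push Not at hns
  obtain ⟨v, hv, hvv⟩ := hns
  refine le_trans ?_ (le_iSup₂_of_le (v ++ v) ⟨mem_language_of_infix hw hvv, by simp [hv]⟩ le_rfl)
  exact_mod_cast two_le_exponent_square hv

theorem two_le_repetitionThreshold (d : ℕ) : 2 ≤ repetitionThreshold (richClass d) :=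
  le_iInf₂ fun _ hu => Rich.two_le_criticalExponent hu

end Squares

/-! ### The substitution, its language, and decoding at the letter 0 -/

section Substitution

/-- The part after the initial `0` of the image of the letter `a` under `expand k K`. -/
def inner (k : ℕ) (K : List ℕ) (a : ℕ) : List ℕ :=
  if a + 1 < k then [a + 1] else if a < k then K else K ++ K

/-- The substitution with `a ↦ 0 (a + 1)` for `a < k - 1`, `k - 1 ↦ 0 K` and `k ↦ 0 K K`. -/
def expand (k : ℕ) (K : List ℕ) (w : List ℕ) : List ℕ :=
  w.flatMap fun a => 0 :: inner k K a

/-- The language of the fixed point of `expand k [k]`. -/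
def lang (k : ℕ) : Set (List ℕ) :=
  {w | ∃ n : ℕ, w <:+: (expand k [k])^[n] [0]}

/-- The language of the image under `expand k K` of the fixed point of `expand k [k]`. -/
def imageLang (k : ℕ) (K : List ℕ) : Set (List ℕ) :=
  {z | ∃ W ∈ lang k, z <:+: expand k K W}

/-- The properties of the word `K` used throughout. -/
structure Marker (k : ℕ) (K : List ℕ) : Prop where
  two_le : 2 ≤ k
  ne_nil : K ≠ []
  reverse_eq : K.reverse = K
  le_of_mem : ∀ x ∈ K, k ≤ x

theorem marker_singleton {k : ℕ} (hk : 2 ≤ k) : Marker k [k] :=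
  ⟨hk, by simp, rfl, by simp⟩

variable {k : ℕ} {K : List ℕ}

@[simp] theorem expand_nil : expand k K [] = [] := rfl

@[simp] theorem expand_cons (a : ℕ) (w : List ℕ) :
    expand k K (a :: w) = 0 :: (inner k K a ++ expand k K w) := by
  simp [expand]

@[simp] theorem expand_append (v w : List ℕ) :
    expand k K (v ++ w) = expand k K v ++ expand k K w := by
  simp [expand]

theorem expand_infix {v w : List ℕ} (h : v <:+: w) : expand k K v <:+: expand k K w := by
  obtain ⟨x, y, rfl⟩ := h
  exact ⟨expand k K x, expand k K y, by simp⟩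

theorem expand_iterate_append (n : ℕ) (v w : List ℕ) :
    (expand k K)^[n] (v ++ w) = (expand k K)^[n] v ++ (expand k K)^[n] w := by
  induction n generalizing v w with
  | zero => rfl
  | succ n ih => simp only [Function.iterate_succ_apply, expand_append, ih]

theorem expand_iterate_infix (n : ℕ) {v w : List ℕ} (h : v <:+: w) :
    (expand k K)^[n] v <:+: (expand k K)^[n] w := by
  obtain ⟨x, y, rfl⟩ := h
  exact ⟨_, _, by rw [expand_iterate_append, expand_iterate_append]⟩

theorem expand_ne_nil {w : List ℕ} (h : w ≠ []) : expand k K w ≠ [] := by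
  cases w with
  | nil => exact absurd rfl h
  | cons a w => simp

theorem expand_iterate_ne_nil (n : ℕ) {w : List ℕ} (h : w ≠ []) :
    (expand k K)^[n] w ≠ [] := by
  induction n generalizing w with
  | zero => exact h
  | succ n ih => rw [Function.iterate_succ_apply]; exact ih (expand_ne_nil h)

namespace Marker

theorem inner_ne_nil (hK : Marker k K) (a : ℕ) : inner k K a ≠ [] := by
  unfold inner
  have := hK.ne_nil
  split_ifs <;> simp [this]

theorem zero_notMem (hK : Marker k K) : 0 ∉ K := fun h => by
  have := hK.le_of_mem 0 h
  have := hK.two_le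
  omega

theorem zero_notMem_inner (hK : Marker k K) (a : ℕ) : 0 ∉ inner k K a := by
  unfold inner
  have := hK.zero_notMem
  split_ifs <;> simp [this]

theorem reverse_inner (hK : Marker k K) (a : ℕ) : (inner k K a).reverse = inner k K a := by
  unfold inner
  split_ifs <;> simp [hK.reverse_eq]

theorem inner_injective (hK : Marker k K) {a b : ℕ} (ha : a ≤ k) (hb : b ≤ k)
    (h : inner k K a = inner k K b) : a = b := by
  have h1 : ∀ i, i < k → K ≠ [i] := fun i hi hc => by
    have := hK.le_of_mem i (by rw [hc]; simp)
    omega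
  have h2 : ∀ i, i < k → K ++ K ≠ [i] := fun i hi hc => by
    have hc' := congrArg List.length hc
    have := List.length_pos_of_ne_nil hK.ne_nil
    simp only [List.length_append, List.length_singleton] at hc'
    omega
  unfold inner at h
  split_ifs at h with h3 h4 h5 h6 h7 h8
  · simpa using h
  · exact absurd h.symm (h1 _ h3)
  · exact absurd h.symm (h2 _ h3)
  · exact absurd h (h1 _ h7)
  · omega
  · simp [hK.ne_nil] at h
  · exact absurd h (h2 _ (by assumption))
  · simp [hK.ne_nil] at h
  · omega

/-- Each block is 0 followed by a palindrome; the extra final 0 restores the symmetry, so that φ(P)0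
is a palindrome whenever P is. -/
theorem reverse_expand (hK : Marker k K) (w : List ℕ) :
    (expand k K w ++ [0]).reverse = expand k K w.reverse ++ [0] := by
  induction w with
  | nil => rfl
  | cons a w ih =>
    rw [List.reverse_append] at ih ⊢
    simp only [expand_cons, List.reverse_cons, List.reverse_append, expand_append, hK.reverse_inner,
      List.reverse_nil, List.nil_append, expand_nil, List.append_nil,
      List.cons_append] at ih ⊢
    rw [← List.cons_append, ← List.cons_append, ih]
    simp

/-- Synchronisation: 0 occurs only at the start of a block, so every 0 in an image marks a cut of
the preimage. -/
theorem zero_split (hK : Marker k K) {W p r : List ℕ} (h : expand k K W = p ++ 0 :: r) :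
    ∃ W1 b W2, W = W1 ++ b :: W2 ∧ p = expand k K W1 ∧ r = inner k K b ++ expand k K W2 := by
  induction W generalizing p with
  | nil => simp at h
  | cons a W ih =>
    rw [expand_cons] at h
    rcases p with _ | ⟨x, p⟩
    · simp only [List.nil_append, List.cons.injEq, true_and] at h
      exact ⟨[], a, W, rfl, rfl, h.symm⟩
    · simp only [List.cons_append, List.cons.injEq] at h
      obtain ⟨hx, h⟩ := h
      rcases List.append_eq_append_iff.1 h with ⟨p', hp, hW⟩ | ⟨c, hc, hr⟩
      · obtain ⟨W1, b, W2, rfl, rfl, rfl⟩ := ih hW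
        exact ⟨a :: W1, b, W2, rfl, by simp [hp, hx], rfl⟩
      · rcases c with _ | ⟨y, c⟩
        · obtain ⟨W1, b, W2, rfl, h1, rfl⟩ := ih (p := []) (by simpa using hr.symm)
          refine ⟨a :: W1, b, W2, rfl, ?_, rfl⟩
          rw [expand_cons, ← h1, hc, hx]
          simp
        · simp only [List.cons_append, List.cons.injEq] at hr
          exact absurd (by rw [hc, ← hr.1]; simp) (hK.zero_notMem_inner a)

end Marker

/-- A zero-free prefix of `x ++ y` is a prefix of `x` if `y` is empty or starts with `0`. -/
theorem prefix_of_zero_notMem {t x y : List ℕ} (ht : 0 ∉ t) (hy : y = [] ∨ ∃ y', y = 0 :: y')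
    (h : t <+: x ++ y) : t <+: x := by
  rcases hy with rfl | ⟨y', rfl⟩
  · simpa using h
  · rcases List.prefix_or_prefix_of_prefix h (List.prefix_append x _) with h1 | ⟨z, rfl⟩
    · exact h1
    · rw [List.prefix_append_right_inj] at h
      rcases z with _ | ⟨c, z⟩
      · simp
      · rw [List.cons_prefix_cons] at h
        exact absurd (by rw [h.1]; simp) ht

theorem expand_eq_nil_or (w : List ℕ) : expand k K w = [] ∨ ∃ y, expand k K w = 0 :: y := by
  cases w with
  | nil => exact Or.inl rfl
  | cons a w => exact Or.inr ⟨_, expand_cons a w⟩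

theorem cons_zero_cancel {s s' x x' : List ℕ} (hs : 0 ∉ s) (hs' : 0 ∉ s')
    (h : s ++ 0 :: x = s' ++ 0 :: x') : s = s' ∧ x = x' := by
  have h1 : s <+: s' := prefix_of_zero_notMem hs (Or.inr ⟨x', rfl⟩) ⟨_, h⟩
  have h2 : s' <+: s := prefix_of_zero_notMem hs' (Or.inr ⟨x, rfl⟩) ⟨_, h.symm⟩
  have := h1.eq_of_length_le h2.length_le
  subst this
  simpa using h

theorem mem_lang_of_infix {v w : List ℕ} (hw : w ∈ lang k) (h : v <:+: w) : v ∈ lang k := by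
  obtain ⟨n, hn⟩ := hw
  exact ⟨n, h.trans hn⟩

theorem mem_imageLang_of_infix {v w : List ℕ} (hw : w ∈ imageLang k K) (h : v <:+: w) :
    v ∈ imageLang k K := by
  obtain ⟨W, hW, hz⟩ := hw
  exact ⟨W, hW, h.trans hz⟩

theorem expand_mem_lang {w : List ℕ} (hw : w ∈ lang k) : expand k [k] w ∈ lang k := by
  obtain ⟨n, hn⟩ := hw
  exact ⟨n + 1, by rw [Function.iterate_succ_apply']; exact expand_infix hn⟩

theorem lang_eq_imageLang (hk : 2 ≤ k) : lang k = imageLang k [k] := by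
  ext w
  constructor
  · rintro ⟨n, hn⟩
    cases n with
    | zero =>
      refine ⟨[0], ⟨0, List.infix_rfl⟩, hn.trans ⟨[], [1], ?_⟩⟩
      simp only [Function.iterate_zero, id_eq, expand_cons, expand_nil, List.append_nil, inner]
      rw [if_pos (by omega)]
      rfl
    | succ n =>
      rw [Function.iterate_succ_apply'] at hn
      exact ⟨_, ⟨n, List.infix_rfl⟩, hn⟩
  · rintro ⟨W, hW, hw⟩
    exact mem_lang_of_infix (expand_mem_lang hW) hw

theorem le_of_mem_lang {w : List ℕ} (hk : 2 ≤ k) (hw : w ∈ lang k) : ∀ x ∈ w, x ≤ k := by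
  rw [lang_eq_imageLang hk] at hw
  obtain ⟨W, -, hw⟩ := hw
  intro x hx
  have := hw.subset hx
  rw [expand, List.mem_flatMap] at this
  obtain ⟨a, -, ha⟩ := this
  unfold inner at ha
  split_ifs at ha <;> simp at ha <;> omega

theorem inner_zero (hk : 2 ≤ k) : inner k K 0 = [1] := by
  rw [inner, if_pos (by omega)]

theorem inner_one (hk : 2 ≤ k) : inner k [k] 1 = [2] := by
  unfold inner
  split_ifs
  · rfl
  · have : k = 2 := by omega
    rw [this]
  · omega

/-- Since φ²(0) = 0102, the factor 102 places each φⁿ(0) between two non-empty words of the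
language. -/
theorem exists_extension {w : List ℕ} (hk : 2 ≤ k) (hw : w ∈ lang k) :
    ∃ a b, a :: (w ++ [b]) ∈ lang k := by
  obtain ⟨n, x, y, hn⟩ := hw
  have h2 : (expand k [k])^[2] [0] = [0, 1, 0, 2] := by
    simp [Function.iterate_succ_apply, inner_zero hk, inner_one hk]
  have h3 : (expand k [k])^[n] ([1] ++ [0] ++ [2]) ∈ lang k :=
    ⟨n + 2, by
      rw [Function.iterate_add_apply, h2]
      exact expand_iterate_infix n ⟨[0], [], rfl⟩⟩
  rw [expand_iterate_append, expand_iterate_append, ← hn] at h3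
  obtain ⟨p, a, hp⟩ := (List.eq_nil_or_concat' ((expand k [k])^[n] [1] ++ x)).resolve_left
    (by simp [expand_iterate_ne_nil])
  obtain ⟨b, q, hq⟩ := List.exists_cons_of_ne_nil (l := y ++ (expand k [k])^[n] [2])
    (by simp [expand_iterate_ne_nil])
  refine ⟨a, b, mem_lang_of_infix h3 ⟨p, q, ?_⟩⟩
  have : (p ++ [a]) ++ w ++ (b :: q) = ((expand k [k])^[n] [1] ++ x) ++ w ++
    (y ++ (expand k [k])^[n] [2]) := by rw [hp, hq]
  simpa using this

/-- Each φⁿ(0) lies in a palindrome P of the language. Inductively P becomes φ(P)0, and the letter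
kept after P guarantees that this 0, and a letter after it, are present. -/
theorem reverse_mem_lang {w : List ℕ} (hk : 2 ≤ k) (hw : w ∈ lang k) : w.reverse ∈ lang k := by
  have hK := marker_singleton hk
  have key : ∀ n : ℕ, ∃ P c, P.reverse = P ∧ (expand k [k])^[n] [0] <:+: P ∧
      P ++ [c] ∈ lang k := by
    intro n
    induction n with
    | zero =>
      refine ⟨[0], 1, rfl, List.infix_rfl, 1, ⟨[], [], ?_⟩⟩
      simp [inner_zero hk]
    | succ n ih =>
      obtain ⟨P, c, hP, hn, hc⟩ := ih
      obtain ⟨d, l, hd⟩ := List.exists_cons_of_ne_nil (hK.inner_ne_nil c)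
      refine ⟨expand k [k] P ++ [0], d, ?_, ?_, ?_⟩
      · rw [hK.reverse_expand, hP]
      · rw [Function.iterate_succ_apply']
        exact (expand_infix hn).trans ⟨[], [0], rfl⟩
      · refine mem_lang_of_infix (expand_mem_lang hc) ⟨[], l, ?_⟩
        simp [hd]
  obtain ⟨n, hn⟩ := hw
  obtain ⟨P, c, hP, hnP, hc⟩ := key n
  have := List.reverse_infix.2 (hn.trans hnP)
  rw [hP] at this
  exact mem_lang_of_infix hc (this.trans ⟨[], [c], rfl⟩)

theorem Marker.suffix_inner (hK : Marker k K) {s W : List ℕ} {a : ℕ} (hs : 0 ∉ s)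
    (h : s <:+ expand k K (W ++ [a])) : s <:+ inner k K a := by
  rw [expand_append, expand_cons, expand_nil, List.append_nil] at h
  rw [← List.reverse_prefix, hK.reverse_inner]
  rw [← List.reverse_prefix] at h
  refine prefix_of_zero_notMem (by simpa using hs) (y := 0 :: (expand k K W).reverse)
    (Or.inr ⟨_, rfl⟩) ?_
  simpa [hK.reverse_inner] using h

/-- The decomposition into images of letters of a factor of the image which contains `0`. -/
theorem Marker.parse (hK : Marker k K) {z : List ℕ} (hz : z ∈ imageLang k K) (h0 : 0 ∈ z) :
    ∃ s V t a b, z = s ++ expand k K V ++ 0 :: t ∧ 0 ∉ s ∧ 0 ∉ t ∧ s <:+ inner k K a ∧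
      t <+: inner k K b ∧ a :: (V ++ [b]) ∈ lang k := by
  obtain ⟨W0, hW0, hzW0⟩ := hz
  obtain ⟨c, d, hW⟩ := exists_extension hK.two_le hW0
  obtain ⟨s, z1, hz1, hs⟩ := List.eq_append_cons_of_mem h0
  obtain ⟨t', z2, hz2, ht⟩ := List.eq_append_cons_of_mem
    (show 0 ∈ (0 :: z1).reverse by simp)
  have hz2' : 0 :: z1 = z2.reverse ++ 0 :: t'.reverse := by
    rw [← List.reverse_reverse (0 :: z1), hz2]; simp
  obtain ⟨p, q, hpq⟩ := hzW0
  have e1 : expand k K (c :: W0) = ((0 :: inner k K c ++ p) ++ s) ++ 0 :: (z1 ++ q) := by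
    rw [expand_cons, ← hpq, hz1]; simp
  obtain ⟨W1, b0, W2, hsplit, hp1, hr1⟩ := hK.zero_split e1
  have e2 : expand k K (b0 :: W2) = z2.reverse ++ 0 :: (t'.reverse ++ q) := by
    rw [expand_cons, ← hr1, ← List.cons_append, hz2']; simp
  obtain ⟨V, b, W3, hsplit2, hp2, hr2⟩ := hK.zero_split e2
  obtain ⟨W1', a, rfl⟩ := (List.eq_nil_or_concat' W1).resolve_left (by rintro rfl; simp at hp1)
  refine ⟨s, V, t'.reverse, a, b, ?_, hs, by simpa using ht, ?_, ?_, ?_⟩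
  · rw [hz1, hz2', hp2]; simp
  · exact hK.suffix_inner hs ⟨_, hp1⟩
  · exact prefix_of_zero_notMem (by simpa using ht) (expand_eq_nil_or W3) ⟨q, hr2⟩
  · refine mem_lang_of_infix hW ⟨W1', W3 ++ [d], ?_⟩
    have : (c :: W0) ++ [d] = W1' ++ [a] ++ (V ++ b :: W3) ++ [d] := by rw [hsplit, hsplit2]
    simpa using this.symm

theorem infix_inner {z : List ℕ} (hz : z ∈ imageLang k K) (h0 : 0 ∉ z) :
    ∃ a, z <:+: inner k K a := by
  obtain ⟨W, -, hzW⟩ := hz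
  obtain ⟨p, q, hpq⟩ := hzW
  induction W generalizing p with
  | nil =>
    have : z = [] := by simp at hpq; exact hpq.2.1
    exact ⟨0, by rw [this]; exact List.nil_infix⟩
  | cons a W ih =>
    rw [expand_cons] at hpq
    rcases p with _ | ⟨x, p⟩
    · rcases z with _ | ⟨y, z⟩
      · exact ⟨0, List.nil_infix⟩
      · simp only [List.nil_append, List.cons_append, List.cons.injEq] at hpq
        exact absurd (by rw [hpq.1]; simp) h0
    · simp only [List.cons_append, List.cons.injEq, List.append_assoc] at hpq
      rcases List.append_eq_append_iff.1 hpq.2 with ⟨c, hc, hW⟩ | ⟨c, hc, hW⟩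
      · refine ⟨a, ?_⟩
        have : z <+: c := prefix_of_zero_notMem h0 (expand_eq_nil_or W) ⟨q, hW⟩
        rw [hc]
        exact this.isInfix.trans (List.infix_append' p c [] |>.trans (by simp))
      · exact ih c (by rw [hW]; simp)

/-- Decoding of a prefix of an image. -/
theorem Marker.decode_prefix (hK : Marker k K) {Y W t : List ℕ} (hY : ∀ y ∈ Y, y ≤ k)
    (hW : ∀ y ∈ W, y ≤ k) (ht : 0 ∉ t) (h : expand k K Y ++ 0 :: t <+: expand k K W) :
    ∃ c, Y ++ [c] <+: W ∧ t <+: inner k K c := by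
  induction Y generalizing W with
  | nil =>
    rcases W with _ | ⟨x, W⟩
    · simp at h
    · rw [expand_cons, expand_nil, List.nil_append, List.cons_prefix_cons] at h
      exact ⟨x, by simp, prefix_of_zero_notMem ht (expand_eq_nil_or W) h.2⟩
  | cons y Y ih =>
    rcases W with _ | ⟨x, W⟩
    · simp at h
    · rw [expand_cons, expand_cons, List.cons_append, List.cons_prefix_cons] at h
      obtain ⟨r, hr⟩ := h.2
      have h1 : ∃ r', expand k K Y ++ 0 :: t ++ r = 0 :: r' := by
        rcases expand_eq_nil_or (k := k) (K := K) Y with h | ⟨r', h⟩ <;> simp [h]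
      have h2 : inner k K y = inner k K x ∧ expand k K Y ++ 0 :: t ++ r = expand k K W := by
        obtain ⟨r', hr'⟩ := h1
        rw [List.append_assoc, List.append_assoc, ← List.append_assoc (expand k K Y), hr'] at hr
        rcases expand_eq_nil_or (k := k) (K := K) W with h | ⟨r'', h⟩
        · rw [h, List.append_nil] at hr
          exact absurd (by rw [← hr]; simp) (hK.zero_notMem_inner x)
        · rw [h] at hr
          have := cons_zero_cancel (hK.zero_notMem_inner y) (hK.zero_notMem_inner x) hr
          exact ⟨this.1, by rw [hr', h, this.2]⟩
      have hyx := hK.inner_injective (hY y (by simp)) (hW x (by simp)) h2.1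
      subst hyx
      obtain ⟨c, hc, htc⟩ := ih (fun z hz => hY z (by simp [hz])) (fun z hz => hW z (by simp [hz]))
        ⟨r, h2.2⟩
      exact ⟨c, by simpa using hc, htc⟩

theorem Marker.expand_injective (hK : Marker k K) {V W : List ℕ} (hV : ∀ y ∈ V, y ≤ k)
    (hW : ∀ y ∈ W, y ≤ k) (h : expand k K V = expand k K W) : V = W := by
  have key : ∀ {V W : List ℕ}, (∀ y ∈ V, y ≤ k) → (∀ y ∈ W, y ≤ k) →
      expand k K V = expand k K W → V <+: W := by
    intro V W hV hW h
    obtain ⟨c, hc, -⟩ := hK.decode_prefix (Y := V) (W := W ++ [0]) (t := []) hV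
      (by simpa [or_imp, forall_and] using hW) (by simp)
      (by rw [expand_append, h]; simp)
    have := hc.length_le
    simp only [List.length_append, List.length_singleton] at this
    exact List.prefix_of_prefix_length_le ((List.prefix_append _ _).trans hc)
      (List.prefix_append _ _) (by omega)
  exact (key hV hW h).eq_of_length_le (key hW hV h.symm).length_le

end Substitution

/-! ### Palindromic extensions and returns in the fixed point -/

section FixedPoint

variable {k : ℕ}

/-- The first and last letter of `inner k [k] a`. -/
def succLetter (k a : ℕ) : ℕ :=
  if a + 1 < k then a + 1 else k

theorem prefix_inner_singleton {t : List ℕ} {b : ℕ} (h : t <+: inner k [k] b) :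
    t = [] ∨ t = [succLetter k b] ∨ (t = [k, k] ∧ k ≤ b) := by
  unfold inner at h
  unfold succLetter
  split_ifs at h with h1 h2
  · rw [if_pos h1]
    rcases List.prefix_cons_iff.1 h with h | ⟨t', rfl, h⟩
    · exact Or.inl h
    · simp at h; simp [h]
  · rw [if_neg h1]
    rcases List.prefix_cons_iff.1 h with h | ⟨t', rfl, h⟩
    · exact Or.inl h
    · simp at h; simp [h]
  · rw [if_neg h1]
    rw [List.singleton_append] at h
    rcases List.prefix_cons_iff.1 h with h | ⟨t', rfl, h2⟩
    · exact Or.inl h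
    · rcases List.prefix_cons_iff.1 h2 with rfl | ⟨t'', rfl, h3⟩
      · exact Or.inr (Or.inl rfl)
      · simp at h3
        exact Or.inr (Or.inr ⟨by simp [h3], by omega⟩)

theorem suffix_inner_singleton (hk : 2 ≤ k) {t : List ℕ} {b : ℕ} (h : t <:+ inner k [k] b) :
    t = [] ∨ t = [succLetter k b] ∨ (t = [k, k] ∧ k ≤ b) := by
  rw [← List.reverse_prefix, (marker_singleton hk).reverse_inner] at h
  rcases prefix_inner_singleton h with h | h | ⟨h, hb⟩
  · exact Or.inl (by simpa using h)
  · exact Or.inr (Or.inl (by simpa using congrArg List.reverse h))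
  · exact Or.inr (Or.inr ⟨by simpa using congrArg List.reverse h, hb⟩)

theorem zero_cons_cancel {x x' t t' : List ℕ} (ht : 0 ∉ t) (ht' : 0 ∉ t')
    (h : x ++ 0 :: t = x' ++ 0 :: t') : x = x' ∧ t = t' := by
  have h' := congrArg List.reverse h
  simp only [List.reverse_append, List.reverse_cons, List.append_assoc, List.singleton_append] at h'
  obtain ⟨h1, h2⟩ := cons_zero_cancel (by simpa using ht) (by simpa using ht') h'
  exact ⟨List.reverse_injective h2, List.reverse_injective h1⟩

theorem adjacent_cases (hk : 2 ≤ k) {x y : ℕ} (h : [x, y] ∈ lang k) :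
    (x = 0 ∧ y ≠ 0) ∨ (x ≠ 0 ∧ y = 0) ∨ (x = k ∧ y = k) := by
  have hK := marker_singleton hk
  rw [lang_eq_imageLang hk] at h
  by_cases h0 : 0 ∈ [x, y]
  · obtain ⟨s, V, t, a, b, he, hs, ht, -⟩ := hK.parse h h0
    rcases V with _ | ⟨c, V⟩
    · rw [expand_nil, List.append_nil] at he
      rcases s with _ | ⟨s1, s⟩
      · simp only [List.nil_append, List.cons.injEq] at he
        refine Or.inl ⟨he.1, ?_⟩
        rintro rfl
        exact ht (by rw [← he.2]; simp)
      · simp only [List.cons_append, List.cons.injEq] at he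
        obtain ⟨rfl, he⟩ := he
        have hs' := congrArg List.length he
        simp only [List.length_cons, List.length_append, List.length_nil] at hs'
        rw [List.eq_nil_of_length_eq_zero (l := s) (by omega)] at he
        simp only [List.nil_append, List.cons.injEq] at he
        refine Or.inr (Or.inl ⟨?_, he.1⟩)
        rintro rfl
        simp at hs
    · have h1 := congrArg List.length he
      have h2 := List.length_pos_of_ne_nil (hK.inner_ne_nil c)
      simp only [List.length_cons, List.length_append, List.length_nil, expand_cons] at h1
      omega
  · obtain ⟨a, ha⟩ := infix_inner h h0
    have hl := ha.length_le
    unfold inner at ha hl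
    split_ifs at ha hl
    · simp at hl
    · simp at hl
    · have := ha.eq_of_length (by simp)
      simp only [List.singleton_append, List.cons.injEq, and_true] at this
      exact Or.inr (Or.inr this)

/-- One step of decoding: as `Y` begins and ends with 0, its two neighbours are the last and first
letters of `inner` of the neighbours of the preimage. -/
theorem parse_bordered (hk : 2 ≤ k) {a b : ℕ} {Y Y1 Y2 : List ℕ} (ha : a ≠ 0) (hb : b ≠ 0)
    (h1 : Y = 0 :: Y1) (h2 : Y = Y2 ++ [0]) (h : a :: (Y ++ [b]) ∈ lang k) :
    ∃ V a' b', Y = expand k [k] V ++ [0] ∧ a' :: (V ++ [b']) ∈ lang k ∧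
      a = succLetter k a' ∧ b = succLetter k b' := by
  rw [lang_eq_imageLang hk] at h
  obtain ⟨s, V, t, a', b', he, hs, ht, hsa, htb, hl⟩ :=
    (marker_singleton hk).parse h (by simp [h1])
  have h3 : ∃ r, expand k [k] V ++ 0 :: t = 0 :: r := by
    rcases expand_eq_nil_or (k := k) (K := [k]) V with h | ⟨r, h⟩ <;> simp [h]
  obtain ⟨r, hr⟩ := h3
  have e1 : [a] ++ 0 :: (Y1 ++ [b]) = s ++ 0 :: r := by
    rw [← hr, ← List.append_assoc, ← he, h1]; simp
  obtain ⟨rfl, -⟩ := cons_zero_cancel (by simpa using ha.symm) hs e1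
  have e2 : (a :: Y2) ++ 0 :: [b] = ([a] ++ expand k [k] V) ++ 0 :: t := by
    rw [← he, h2]; simp
  obtain ⟨h4, rfl⟩ := zero_cons_cancel (by simpa using hb.symm) ht e2
  refine ⟨V, a', b', ?_, hl, ?_, ?_⟩
  · rw [h2]; simpa using h4
  · rcases suffix_inner_singleton hk hsa with h | h | h
    · simp at h
    · simpa using h
    · simp at h
  · rcases prefix_inner_singleton htb with h | h | h
    · simp at h
    · simpa using h
    · simp at h

/-- The hub property: the pairs of letters by which a palindrome can be extended on its two sides,
apart from `(k, k)`, all have the same minimum. -/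
theorem extension_hub (hk : 2 ≤ k) {Y : List ℕ} (hY : Y.reverse = Y) {a b c d : ℕ}
    (h1 : a :: (Y ++ [b]) ∈ lang k) (h2 : c :: (Y ++ [d]) ∈ lang k) (hab : ¬ (a = k ∧ b = k))
    (hcd : ¬ (c = k ∧ d = k)) : min a b = min c d := by
  induction hn : Y.length using Nat.strong_induction_on generalizing Y a b c d with
  | _ n ih =>
  subst hn
  rcases Y with _ | ⟨y, Y1⟩
  · have := adjacent_cases hk h1
    have := adjacent_cases hk h2
    omega
  obtain ⟨Y2, y2, hY2⟩ := (List.eq_nil_or_concat' (y :: Y1)).resolve_left (by simp)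
  have hyy : y2 = y := by
    have := hY
    rw [hY2] at this
    simp only [List.reverse_append, List.reverse_singleton, List.singleton_append] at this
    rw [← hY2] at this
    exact (List.cons.inj this).1
  subst hyy
  have hadj : ∀ {a b}, a :: ((y2 :: Y1) ++ [b]) ∈ lang k →
      [a, y2] ∈ lang k ∧ [y2, b] ∈ lang k := fun {a b} h =>
    ⟨mem_lang_of_infix h ⟨[], Y1 ++ [b], by simp⟩,
      mem_lang_of_infix h ⟨a :: Y2, [], by rw [hY2]; simp⟩⟩
  have ha1 := adjacent_cases hk (hadj h1).1
  have ha2 := adjacent_cases hk (hadj h1).2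
  have hc1 := adjacent_cases hk (hadj h2).1
  have hc2 := adjacent_cases hk (hadj h2).2
  -- If `Y` is bordered by 0, both pairs decode, and the monotone map `succLetter k`, which is min(x
  -- + 1, k) on the alphabet, commutes with the minimum. If its border letter is not 0, a neighbour
  -- is 0 or k, so a pair other than (k, k) has minimum 0.
  by_cases hy : y2 = 0
  · subst hy
    obtain ⟨V, a', b', hV, hl, rfl, rfl⟩ :=
      parse_bordered hk (by omega) (by omega) rfl hY2 h1
    obtain ⟨V', c', d', hV', hl', rfl, rfl⟩ :=
      parse_bordered hk (by omega) (by omega) rfl hY2 h2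
    have hm1 := le_of_mem_lang hk hl
    have hm2 := le_of_mem_lang hk hl'
    have hVV : V = V' := (marker_singleton hk).expand_injective
      (fun y hy => hm1 y (by simp [hy])) (fun y hy => hm2 y (by simp [hy]))
      (List.append_left_injective [0] (hV.symm.trans hV'))
    subst hVV
    have hrev : V.reverse = V := by
      have := (marker_singleton hk).reverse_expand V
      rw [← hV, hY, hV] at this
      exact ((marker_singleton hk).expand_injective
        (fun y hy => hm1 y (by simp [hy])) (fun y hy => hm1 y (by simp at hy; simp [hy]))
        (List.append_left_injective [0] this)).symm
    have hlen : V.length < (0 :: Y1).length := by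
      rw [hV]
      have : ∀ W : List ℕ, W.length ≤ (expand k [k] W).length := fun W => by
        induction W with
        | nil => simp
        | cons x W ih => rw [expand_cons]; simp only [List.length_cons, List.length_append]; omega
      have := this V
      simp only [List.length_append, List.length_singleton]
      omega
    have := ih _ hlen hrev hl hl' (fun h => hab (by simp [h, succLetter]))
      (fun h => hcd (by simp [h, succLetter])) rfl
    have := hm1 a' (by simp)
    have := hm1 b' (by simp)
    have := hm2 c' (by simp)
    have := hm2 d' (by simp)
    unfold succLetter at *
    split_ifs at * <;> omega
  · omega

/-- A return from `i` to a larger letter through smaller letters is a palindrome. -/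
theorem palindrome_of_lt (hk : 2 ≤ k) {i b : ℕ} {Z : List ℕ} (hi : i < k) (hb : i < b)
    (h : i :: (Z ++ [b]) ∈ lang k) (hZ : ∀ x ∈ Z, x < i) : Z.reverse = Z := by
  induction i generalizing b Z with
  | zero => rw [List.eq_nil_iff_forall_not_mem.2 fun x hx => absurd (hZ x hx) (by simp)]; rfl
  | succ i ih =>
    rcases Z with _ | ⟨z, Z1⟩
    · rfl
    obtain ⟨Z2, z2, hZ2⟩ := (List.eq_nil_or_concat' (z :: Z1)).resolve_left (by simp)
    have hz := hZ z (by simp)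
    have hz2 := hZ z2 (by rw [hZ2]; simp)
    have h1 := adjacent_cases hk (mem_lang_of_infix h
      (show [i + 1, z] <:+: _ from ⟨[], Z1 ++ [b], by simp⟩))
    have h2 := adjacent_cases hk (mem_lang_of_infix h
      (show [z2, b] <:+: _ from ⟨(i + 1) :: Z2, [], by rw [hZ2]; simp⟩))
    obtain rfl : z = 0 := by omega
    obtain rfl : z2 = 0 := by omega
    obtain ⟨V, a', b', hV, hl, ha, rfl⟩ := parse_bordered hk (by omega) (by omega) rfl hZ2 h
    have ha' : a' = i := by unfold succLetter at ha; split_ifs at ha <;> omega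
    subst ha'
    have hb' : a' < b' := by unfold succLetter at hb; split_ifs at hb <;> omega
    have := ih (by omega) hb' hl fun x hx => by
      have hmem : succLetter k x ∈ (0 :: Z1) := by
        obtain ⟨p, q, rfl⟩ := List.append_of_mem hx
        rw [hV, expand_append, expand_cons]
        unfold succLetter inner
        split_ifs <;> simp
      have := hZ _ hmem
      unfold succLetter at this
      split_ifs at this <;> omega
    rw [hV, (marker_singleton hk).reverse_expand, this]

/-- An occurrence of `i < k` preceded somewhere by a larger letter is preceded by a long word. -/
theorem iterate_suffix (hk : 2 ≤ k) {i a : ℕ} {y : List ℕ} (hi : i < k) (ha : i < a)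
    (h : a :: (y ++ [i]) ∈ lang k) : (expand k [k])^[i] [0] <:+ y ++ [i] := by
  induction i generalizing a y with
  | zero => exact List.suffix_append _ _
  | succ i ih =>
    induction y generalizing a with
    | nil =>
      have := adjacent_cases hk h
      omega
    | cons c y ihy =>
      have h1 := adjacent_cases hk (mem_lang_of_infix h
        (show [a, c] <:+: _ from ⟨[], y ++ [i + 1], by simp⟩))
      -- A non-zero letter after `a` can only be k, which still exceeds i + 1, so `a` may be
      -- dropped.
      by_cases hc : c = 0
      · subst hc
        obtain ⟨y2, c2, hy2⟩ := (List.eq_nil_or_concat' (0 :: y)).resolve_left (by simp)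
        have h2 := adjacent_cases hk (mem_lang_of_infix h
          (show [c2, i + 1] <:+: _ from ⟨a :: y2, [], by rw [hy2]; simp⟩))
        obtain rfl : c2 = 0 := by omega
        obtain ⟨V, a', b', hV, hl, rfl, hb⟩ := parse_bordered hk (by omega) (by omega) rfl hy2 h
        have hb' : b' = i := by unfold succLetter at hb; split_ifs at hb <;> omega
        subst hb'
        have ha' : b' < a' := by unfold succLetter at ha; split_ifs at ha <;> omega
        obtain ⟨p, hp⟩ := ih (by omega) ha' hl
        rw [Function.iterate_succ_apply', hV]
        refine ⟨expand k [k] p, ?_⟩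
        rw [← expand_append, hp, expand_append, expand_cons, inner, if_pos hi]
        simp
      · have hmem : c :: (y ++ [i + 1]) ∈ lang k :=
          mem_lang_of_infix h ⟨[a], [], by simp⟩
        exact (ihy (by omega) hmem).trans ⟨[c], by simp⟩

end FixedPoint

/-! ### Complete returns to palindromes in the image -/

section Returns

variable {k : ℕ} {K : List ℕ}

/-- Letters below k - 1 give distinct single letters below k, whereas the letters of `K` are at
least k. Within the alphabet, only k - 1 and k can be confused. -/
theorem Marker.le_of_mem_inner (hK : Marker k K) {a c x : ℕ} (hac : a ≠ c) (hxa : x ∈ inner k K a) (hxc : x ∈ inner k K c) : k ≤ a + 1 ∧ k ≤ c + 1 := by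
  have h : ∀ {e}, x ∈ inner k K e → (e + 1 < k ∧ x = e + 1) ∨ (k ≤ e + 1 ∧ k ≤ x) := fun {e} h => by
    unfold inner at h
    split_ifs at h
    · simp at h; omega
    · have := hK.le_of_mem x h; omega
    · have := hK.le_of_mem x (by simpa using h); omega
  have := h hxa
  have := h hxc
  omega

theorem inner_suffix {a : ℕ} (ha : k ≤ a + 1) : inner k K a <:+ K ++ K := by
  unfold inner
  split_ifs
  · omega
  · exact List.suffix_append K K
  · exact List.suffix_rfl

theorem length_expand_ge (hK : Marker k K) (W : List ℕ) :
    2 * W.length ≤ (expand k K W).length := by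
  induction W with
  | nil => simp
  | cons x W ih =>
    have := List.length_pos_of_ne_nil (hK.inner_ne_nil x)
    rw [expand_cons]
    simp only [List.length_cons, List.length_append]
    omega

theorem Marker.prefix_parse (hK : Marker k K) {s s1 t t1 V Y : List ℕ} {b : ℕ} (hs : 0 ∉ s)
    (hs1 : 0 ∉ s1) (ht1 : 0 ∉ t1) (htb : t <+: inner k K b) (hY : ∀ y ∈ Y, y ≤ k)
    (hV : ∀ y ∈ V ++ [b], y ≤ k)
    (h : s1 ++ expand k K Y ++ 0 :: t1 <+: s ++ expand k K V ++ 0 :: t) :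
    s1 = s ∧ ∃ c, Y ++ [c] <+: V ++ [b] ∧ t1 <+: inner k K c := by
  obtain ⟨A, hA⟩ := h
  have h1 : ∀ (W t : List ℕ), ∃ r, expand k K W ++ 0 :: t = 0 :: r := fun W t => by
    rcases expand_eq_nil_or (k := k) (K := K) W with h | ⟨r', h⟩ <;> simp [h]
  obtain ⟨r1, hr1⟩ := h1 Y (t1 ++ A)
  obtain ⟨r2, hr2⟩ := h1 V t
  have e : s1 ++ 0 :: r1 = s ++ 0 :: r2 := by
    rw [← hr1, ← hr2, ← List.append_assoc s, ← hA]; simp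
  obtain ⟨rfl, rfl⟩ := cons_zero_cancel hs1 hs e
  refine ⟨rfl, hK.decode_prefix hY hV ht1 ?_⟩
  obtain ⟨q, hq⟩ := htb
  refine ⟨A ++ q, ?_⟩
  have : expand k K Y ++ 0 :: (t1 ++ A) = expand k K V ++ 0 :: t := hr1.trans hr2.symm
  rw [expand_append, expand_cons, ← hq, expand_nil, List.append_nil, List.append_assoc,
    List.cons_append, ← List.append_assoc t1, ← List.cons_append, ← List.append_assoc, this]
  simp

theorem Marker.reverse_image (hK : Marker k K) (s V t : List ℕ) :
    (s ++ expand k K V ++ 0 :: t).reverse =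
      t.reverse ++ expand k K V.reverse ++ 0 :: s.reverse := by
  have : s ++ expand k K V ++ 0 :: t = s ++ (expand k K V ++ [0]) ++ t := by simp
  rw [this, List.reverse_append, List.reverse_append, hK.reverse_expand]
  simp

/-- Complete returns to palindromes which contain `0` are palindromes. -/
theorem Marker.return_of_zero_mem (hK : Marker k K) {R P : List ℕ}
    (ih : ∀ W ∈ lang k, W.length < R.length → ReturnPalindrome W) (hR : R ∈ imageLang k K)
    (h0 : 0 ∈ P) (hP : P.reverse = P) (hpre : P <+: R) (hsuf : P <:+ R) (hne : P ≠ R)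
    (hint : ∀ x y, R = x ++ P ++ y → x = [] ∨ y = []) : R.reverse = R := by
  obtain ⟨s, V, t, a, b, hReq, hs, ht, hsa, htb, hC⟩ := hK.parse hR (hpre.subset h0)
  obtain ⟨s1, Y, t1, a1, b1, hPeq, hs1, ht1, -, -, hC1⟩ :=
    hK.parse (mem_imageLang_of_infix hR hpre.isInfix) h0
  have hm := le_of_mem_lang hK.two_le hC
  have hm1 := le_of_mem_lang hK.two_le hC1
  have hYk : ∀ y ∈ Y, y ≤ k := fun y hy => hm1 y (by simp [hy])
  obtain ⟨rfl, c, hc, htc⟩ := hK.prefix_parse hs hs1 ht1 htb hYk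
    (fun y hy => hm y (List.mem_cons_of_mem _ hy)) (hPeq ▸ hReq ▸ hpre)
  have hsuf' : P <+: R.reverse := by rw [← hP]; exact List.reverse_prefix.2 hsuf
  obtain ⟨hts, c', hc', htc'⟩ := hK.prefix_parse (s := t.reverse) (V := V.reverse)
    (t := s1.reverse) (b := a) (by simpa using ht) hs1 ht1
    (by rw [← hK.reverse_inner]; exact List.reverse_prefix.2 hsa) hYk
    (fun y hy => hm y (by simp at hy ⊢; tauto)) (by
      rw [← hK.reverse_image, ← hReq, ← hPeq]; exact hsuf')
  have hPP := hP
  rw [hPeq, hK.reverse_image] at hPP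
  have hYY : t1 = s1.reverse ∧ Y.reverse = Y := by
    have h1 : ∀ (W t : List ℕ), ∃ r, expand k K W ++ 0 :: t = 0 :: r := fun W t => by
      rcases expand_eq_nil_or (k := k) (K := K) W with h | ⟨r', h⟩ <;> simp [h]
    obtain ⟨h2, h3⟩ := zero_cons_cancel (by simpa using hs1) ht1 hPP
    refine ⟨h3.symm, hK.expand_injective (by simpa using hYk) hYk ?_⟩
    have h4 : t1.reverse = s1 := by rw [← h3]; simp
    rw [h4] at h2
    simpa using h2
  obtain ⟨rfl, hYrev⟩ := hYY
  have htr : t = s1.reverse := by rw [hts]; simp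
  subst htr
  suffices hV : V.reverse = V by rw [hReq, hK.reverse_image, hV]; simp
  have hsuffix : ∀ {e}, s1.reverse <+: inner k K e → s1 <:+ inner k K e := fun {e} h => by
    rw [← List.reverse_prefix, hK.reverse_inner]; exact h
  have hsb := hsuffix htb
  have hsc := hsuffix htc
  have hsc' := hsuffix htc'
  have hYV : Y ≠ V := by rintro rfl; exact hne (hPeq.trans hReq.symm)
  have hlen : 2 * V.length + 2 * s1.length + 1 ≤ R.length := by
    have := length_expand_ge hK V
    rw [hReq]
    simp only [List.length_append, List.length_cons, List.length_reverse]
    omega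
  have hE1 : a :: (Y ++ [c]) <+: a :: (V ++ [b]) := by
    rw [List.cons_prefix_cons]; exact ⟨rfl, hc⟩
  have hE2 : c' :: (Y ++ [b]) <:+ a :: (V ++ [b]) := by
    rw [← List.reverse_prefix]
    simpa [hYrev] using hc'
  -- Such an inner occurrence of `c1 Y d1` would produce an occurrence of `P` strictly inside `R`.
  have hinterior : ∀ x y c1 d1, a :: (V ++ [b]) = x ++ c1 :: (Y ++ [d1]) ++ y → x ≠ [] → y ≠ [] →
      s1 <:+ inner k K c1 → s1 <:+ inner k K d1 → False := by
    intro x y c1 d1 he hx hy h1 h2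
    obtain ⟨x0, x', rfl⟩ := List.exists_cons_of_ne_nil hx
    obtain ⟨y', y0, rfl⟩ := (List.eq_nil_or_concat' y).resolve_left hy
    simp only [List.cons_append, List.cons.injEq] at he
    obtain ⟨-, he⟩ := he
    rw [← List.append_assoc] at he
    obtain ⟨he, -⟩ := List.append_inj' he rfl
    obtain ⟨p, hp⟩ := h1
    rw [← List.reverse_prefix, hK.reverse_inner] at h2
    obtain ⟨q, hq⟩ := h2
    have := hint (s1 ++ expand k K x' ++ 0 :: p) (q ++ expand k K y' ++ 0 :: s1.reverse) (by
      rw [hReq, he, hPeq]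
      simp only [expand_append, expand_cons, expand_nil, ← hp, ← hq]
      simp)
    simp at this
  -- If every occurrence of `Y` comes with neighbours compatible with `P`, then `V` is a complete
  -- return to `Y` (or has at most one letter when `Y` is empty).
  have hVY : (∀ c1 d1, c1 :: (Y ++ [d1]) <:+: a :: (V ++ [b]) →
      s1 <:+ inner k K c1 ∧ s1 <:+ inner k K d1) → V.reverse = V := by
    intro hall
    have hint' : ∀ x y, V = x ++ Y ++ y → x = [] ∨ y = [] := by
      intro x y he
      by_contra hcon
      push Not at hcon
      obtain ⟨x', c1, rfl⟩ := (List.eq_nil_or_concat' x).resolve_left hcon.1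
      obtain ⟨d1, y', rfl⟩ := List.exists_cons_of_ne_nil hcon.2
      have he' : a :: (V ++ [b]) = (a :: x') ++ c1 :: (Y ++ [d1]) ++ (y' ++ [b]) := by
        rw [he]; simp
      have := hall c1 d1 ⟨_, _, he'.symm⟩
      exact hinterior _ _ c1 d1 he' (by simp) (by simp) this.1 this.2
    by_cases hYn : Y = []
    · subst hYn
      rcases V with _ | ⟨v, _ | ⟨w, V⟩⟩
      · rfl
      · rfl
      · have := hint' [v] (w :: V) rfl
        simp at this
    · have hl1 : Y.length ≤ V.length := by
        have := hc.length_le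
        simpa using this
      refine ih V (mem_lang_of_infix hC ⟨[a], [b], by simp⟩) (by omega) Y hYn hYrev ?_ ?_ hYV hint'
      · exact List.prefix_of_prefix_length_le ((List.prefix_append _ _).trans hc)
          (List.prefix_append _ _) hl1
      · rw [← List.reverse_prefix, hYrev]
        exact List.prefix_of_prefix_length_le ((List.prefix_append _ _).trans hc')
          (List.prefix_append _ _) (by simpa using hl1)
  have hak := hm a (by simp)
  have hbk := hm b (by simp)
  have hck := hm c (hE1.subset (by simp))
  have hck' := hm c' (hE2.subset (by simp))
  rcases List.eq_nil_or_concat' s1 with rfl | ⟨s', x, hs'⟩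
  · exact hVY fun c1 d1 _ => ⟨List.nil_suffix, List.nil_suffix⟩
  have hxs : x ∈ s1 := by rw [hs']; simp
  have hspos : 0 < s1.length := List.length_pos_of_mem hxs
  have hfam : ∀ {e f}, s1 <:+ inner k K e → s1 <:+ inner k K f → e ≠ f →
      k ≤ e + 1 ∧ k ≤ f + 1 := fun h1 h2 hef =>
    hK.le_of_mem_inner hef (h1.subset hxs) (h2.subset hxs)
  have h1 := hfam hsa hsc
  have h2 := hfam hsa hsc'
  have h3 := hfam hsa hsb
  -- If the four outer letters coincide, `a V a` is a complete return to `a Y a`. Otherwise both k -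
  -- 1 and k are compatible with `P`, and by the hub property no other letter is adjacent to `Y`
  -- here.
  by_cases hall : a = c ∧ a = c' ∧ a = b
  · obtain ⟨rfl, rfl, rfl⟩ := hall
    have := ih _ hC (by simp; omega) (a :: (Y ++ [a])) (by simp) (by simp [hYrev]) hE1 hE2
      (by simpa using hYV) (fun x y he => by
        by_contra hcon
        push Not at hcon
        exact hinterior x y a a he hcon.1 hcon.2 hsa hsa)
    simpa using this
  · have hall' : a ≠ c ∨ a ≠ c' ∨ a ≠ b := by omega
    have hfam2 : ∀ e, e ≤ k → k ≤ e + 1 → s1 <:+ inner k K e := by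
      intro e he1 he2
      by_cases hea : e = a
      · exact hea ▸ hsa
      · rcases hall' with h | h | h
        · have : e = c := by have := h1 h; omega
          exact this ▸ hsc
        · have : e = c' := by have := h2 h; omega
          exact this ▸ hsc'
        · have : e = b := by have := h3 h; omega
          exact this ▸ hsb
    refine hVY fun c1 d1 hcd => ?_
    have hcdl := mem_lang_of_infix hC hcd
    have hc1 := hm c1 (hcd.subset (by simp))
    have hd1 := hm d1 (hcd.subset (by simp))
    have hhub1 := extension_hub hK.two_le hYrev (mem_lang_of_infix hC hE1.isInfix) hcdl
    have hhub2 := extension_hub hK.two_le hYrev (mem_lang_of_infix hC hE2.isInfix) hcdl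
    have hge : k ≤ c1 + 1 ∧ k ≤ d1 + 1 := by
      by_cases hkk : c1 = k ∧ d1 = k
      · omega
      · have h4 : ¬(a = k ∧ c = k) → min a c = min c1 d1 := fun h => hhub1 h hkk
        have h5 : ¬(c' = k ∧ b = k) → min c' b = min c1 d1 := fun h => hhub2 h hkk
        omega
    exact ⟨hfam2 _ hc1 hge.1, hfam2 _ hd1 hge.2⟩

/-- Complete returns to palindromes which do not contain `0` are palindromes. -/
theorem Marker.return_of_zero_notMem (hK : Marker k K) (hKK : PalindromicReturns (K ++ K))
    {R P : List ℕ} (ih : ∀ W ∈ lang k, W.length < R.length → ReturnPalindrome W)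
    (hR : R ∈ imageLang k K) (h0 : 0 ∉ P) (hPn : P ≠ []) (hP : P.reverse = P) (hpre : P <+: R)
    (hsuf : P <:+ R) (hne : P ≠ R)
    (hint : ∀ x y, R = x ++ P ++ y → x = [] ∨ y = []) : R.reverse = R := by
  have hPpos := List.length_pos_of_ne_nil hPn
  by_cases hR0 : 0 ∈ R
  swap
  · obtain ⟨a, ha⟩ := infix_inner hR hR0
    by_cases hak : k ≤ a + 1
    · exact hKK R (ha.trans (inner_suffix hak).isInfix) P hPn hP hpre hsuf hne hint
    · rw [inner, if_pos (by omega)] at ha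
      have h1 := ha.length_le
      exact absurd (hpre.eq_of_length_le (by simp at h1; omega)) hne
  obtain ⟨s, V, t, a, b, hReq, hs, ht, hsa, htb, hC⟩ := hK.parse hR hR0
  have hm := le_of_mem_lang hK.two_le hC
  have h1 : ∀ (W t : List ℕ), ∃ r, expand k K W ++ 0 :: t = 0 :: r := fun W t => by
    rcases expand_eq_nil_or (k := k) (K := K) W with h | ⟨r', h⟩ <;> simp [h]
  have hPs : P <+: s := by
    obtain ⟨r, hr⟩ := h1 V t
    refine prefix_of_zero_notMem h0 (Or.inr ⟨r, rfl⟩) ?_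
    rw [← hr, ← List.append_assoc, ← hReq]
    exact hpre
  have hPt : P <+: t.reverse := by
    obtain ⟨r, hr⟩ := h1 V.reverse s.reverse
    refine prefix_of_zero_notMem h0 (Or.inr ⟨r, rfl⟩) ?_
    rw [← hr, ← List.append_assoc, ← hK.reverse_image, ← hReq, ← hP]
    exact List.reverse_prefix.2 hsuf
  have hta : t.reverse <:+ inner k K b := by
    rw [← List.reverse_prefix, hK.reverse_inner]; simpa using htb
  have hPa : P <:+: inner k K a := hPs.isInfix.trans hsa.isInfix
  have hPb : P <:+: inner k K b := hPt.isInfix.trans hta.isInfix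
  have hinterior : ∀ e ∈ V, ¬ P <:+: inner k K e := by
    rintro e he ⟨x, y, hxy⟩
    obtain ⟨p, q, rfl⟩ := List.append_of_mem he
    have := hint (s ++ expand k K p ++ 0 :: x) (y ++ expand k K q ++ 0 :: t) (by
      rw [hReq]; simp [← hxy])
    simp at this
  have hlen : V.length + 2 < R.length := by
    have := length_expand_ge hK V
    have := hPs.length_le
    have := hPt.length_le
    rw [hReq]
    simp only [List.length_append, List.length_cons, List.length_reverse] at *
    omega
  obtain ⟨x, P', hxP⟩ := List.exists_cons_of_ne_nil hPn
  have hxP' : x ∈ P := by rw [hxP]; simp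
  have hfam : a ≠ b → k ≤ a + 1 ∧ k ≤ b + 1 := fun h =>
    hK.le_of_mem_inner h (hPa.subset hxP') (hPb.subset hxP')
  -- Both are suffixes of a common word, `inner k K a` or `K ++ K`. If one were properly contained
  -- in the other, `P` would occur strictly inside `R`.
  have hts : t.reverse = s := by
    have hcommon : s <:+ t.reverse ∨ t.reverse <:+ s := by
      by_cases hab : a = b
      · subst hab
        exact List.suffix_or_suffix_of_suffix hsa hta
      · exact List.suffix_or_suffix_of_suffix (hsa.trans (inner_suffix (hfam hab).1))
          (hta.trans (inner_suffix (hfam hab).2))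
    rcases hcommon with ⟨m, hm⟩ | ⟨m, hm⟩
    · obtain ⟨q, hq⟩ := hPs
      have h2 : t = q.reverse ++ P ++ m.reverse := by
        rw [← List.reverse_reverse t, ← hm, ← hq]; simp [hP]
      have := hint (s ++ expand k K V ++ 0 :: q.reverse) m.reverse (by rw [hReq, h2]; simp)
      have : m = [] := by simpa using this
      rw [← hm, this]; simp
    · obtain ⟨q, hq⟩ := hPt
      have := hint m (q ++ expand k K V ++ 0 :: t) (by rw [hReq, ← hm, ← hq]; simp)
      have : m = [] := by simpa using this
      rw [← hm, this]; simp
  -- Either `a V a` is a complete return to the letter `a`, or the outer letters are k - 1 and k and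
  -- all letters of `V` are smaller.
  have hV : V.reverse = V := by
    by_cases hab : a = b
    · subst hab
      have := ih _ hC (by simpa using hlen) [a] (by simp) rfl (by simp)
        ⟨a :: V, by simp⟩ (by simp) (fun x y he => by
          by_contra hcon
          push Not at hcon
          obtain ⟨x0, x', rfl⟩ := List.exists_cons_of_ne_nil hcon.1
          obtain ⟨y', y0, rfl⟩ := (List.eq_nil_or_concat' y).resolve_left hcon.2
          simp only [List.cons_append, List.cons.injEq] at he
          have he2 := he.2
          rw [← List.append_assoc] at he2
          obtain ⟨he2, -⟩ := List.append_inj' he2 rfl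
          exact hinterior a (by rw [he2]; simp) hPa)
      simpa using this
    · have h2 := hfam hab
      have hak := hm a (by simp)
      have hbk := hm b (by simp)
      have hlt : ∀ e ∈ V, e < k - 1 := by
        intro e he
        have hek := hm e (by simp [he])
        by_contra hcon
        have : e = a ∨ e = b := by omega
        rcases this with rfl | rfl
        · exact hinterior _ he hPa
        · exact hinterior _ he hPb
      have h2k := hK.two_le
      rcases lt_or_gt_of_ne hab with h | h
      · have ha : a = k - 1 := by omega
        rw [ha] at hC
        exact palindrome_of_lt h2k (by omega) (by omega) hC hlt
      · have hb : b = k - 1 := by omega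
        rw [hb] at hC
        have hC' := reverse_mem_lang h2k hC
        have h3 := palindrome_of_lt (Z := V.reverse) (i := k - 1) (b := a) h2k (by omega) (by omega)
          (by simpa using hC') (by simpa using hlt)
        simpa using h3.symm
  rw [hReq, hK.reverse_image, hV, hts, ← hts]
  simp

theorem Marker.returnPalindrome_image (hK : Marker k K) (hKK : PalindromicReturns (K ++ K))
    {R : List ℕ} (ih : ∀ W ∈ lang k, W.length < R.length → ReturnPalindrome W)
    (hR : R ∈ imageLang k K) : ReturnPalindrome R := by
  intro P hPn hP hpre hsuf hne hint
  by_cases h0 : 0 ∈ P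
  · exact hK.return_of_zero_mem ih hR h0 hP hpre hsuf hne hint
  · exact hK.return_of_zero_notMem hKK ih hR h0 hPn hP hpre hsuf hne hint

/-- The word `k (k+1) ⋯ (k+m) ⋯ (k+1) k`. -/
def mountain (k m : ℕ) : List ℕ :=
  List.ofFn fun i : Fin (2 * m + 1) => k + min (i : ℕ) (2 * m - i)

theorem length_mountain (k m : ℕ) : (mountain k m).length = 2 * m + 1 := by simp [mountain]

theorem marker_mountain {k : ℕ} (hk : 2 ≤ k) (m : ℕ) : Marker k (mountain k m) := by
  refine ⟨hk, ?_, ?_, ?_⟩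
  · intro h
    have := length_mountain k m
    simp [h] at this
  · refine List.ext_getElem (by simp) fun i h1 h2 => ?_
    rw [length_mountain] at h2
    simp only [mountain, List.getElem_reverse, List.getElem_ofFn, List.length_ofFn]
    omega
  · intro x hx
    simp only [mountain, List.mem_ofFn] at hx
    obtain ⟨i, rfl⟩ := hx
    omega

theorem mountain_zero (k : ℕ) : mountain k 0 = [k] := by simp [mountain]

/-- The height of the letter at position `i` of two consecutive mountains. -/
def height (m i : ℕ) : ℕ :=
  if i < 2 * m + 1 then min i (2 * m - i) else min (i - (2 * m + 1)) (4 * m + 1 - i)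

theorem getElem_mountain_mountain (k m i : ℕ) (hi : i < (mountain k m ++ mountain k m).length) :
    (mountain k m ++ mountain k m)[i] = k + height m i := by
  have hi' := hi
  rw [List.length_append, length_mountain] at hi'
  rw [List.getElem_append, height]
  split_ifs with h1 h2 h2
  · simp only [mountain, List.getElem_ofFn]
  · rw [length_mountain] at h1; omega
  · rw [length_mountain] at h1; omega
  · simp only [mountain, List.getElem_ofFn, List.length_ofFn]
    omega

theorem getElem_of_infix_mountain {k m : ℕ} {x z y : List ℕ}
    (h : x ++ z ++ y = mountain k m ++ mountain k m) (t : ℕ) (ht : t < z.length) :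
    z[t] = k + height m (x.length + t) := by
  have hlen := congrArg List.length h
  rw [← getElem_mountain_mountain k m (x.length + t) (by
    simp only [List.length_append] at hlen ⊢; omega)]
  simp [← h, ht]

/-- Positions of equal height are exchanged by the reflection in the first peak, in the junction or
in the second peak, or by the translation by one mountain. -/
theorem height_eq {m i j : ℕ} (hij : i < j) (hj : j < 4 * m + 2) (h : height m i = height m j) :
    i + j = 2 * m ∨ i + j = 4 * m + 1 ∨ i + j = 6 * m + 2 ∨ j = i + (2 * m + 1) := by
  unfold height at h
  split_ifs at h <;> omega

theorem height_reflect {m i j : ℕ} (h : i + j = 2 * m ∨ i + j = 4 * m + 1 ∨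
    (i + j = 6 * m + 2 ∧ i < 4 * m + 2 ∧ j < 4 * m + 2)) : height m i = height m j := by
  unfold height
  split_ifs <;> omega

/-- It suffices that the end positions of `R` are symmetric about a peak or the junction (`hsum`).
For a one-letter `P` this holds because a mirror image is the next occurrence. For a longer `P`,
matching two consecutive letters forces the shift 2m + 1, which carries the symmetry of the ends of
`P` over to those of `R`. -/
theorem palindromicReturns_mountain (k m : ℕ) :
    PalindromicReturns (mountain k m ++ mountain k m) := by
  rintro R ⟨x, y, hxy⟩ P hPn hP ⟨A, hA⟩ ⟨C, hC⟩ hne hint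
  have hlenKK : (mountain k m ++ mountain k m).length = 4 * m + 2 := by
    simp [length_mountain]; omega
  have hlen := congrArg List.length hxy
  rw [hlenKK] at hlen
  simp only [List.length_append] at hlen
  have hRf := getElem_of_infix_mountain hxy
  have hAl := congrArg List.length hA
  have hCl := congrArg List.length hC
  simp only [List.length_append] at hAl hCl
  have hPpos := List.length_pos_of_ne_nil hPn
  have hCpos : 0 < C.length := by
    rcases C with _ | ⟨c, C⟩
    · exact absurd hC hne
    · simp
  have hP1 : ∀ t (ht : t < P.length), P[t] = k + height m (x.length + t) := by
    intro t ht
    rw [← hRf t (by omega)]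
    simp [← hA, ht]
  have hP2 : P[0] = k + height m (x.length + C.length) := by
    rw [← hRf C.length (by omega)]
    simp [← hC]
  have hP3 : P[0] = P[P.length - 1] := by
    have : P.reverse[0]'(by simpa using hPpos) = P[P.length - 1] := by
      rw [List.getElem_reverse]; simp
    rw [← this]
    congr 1
    exact hP.symm
  have h0 := hP1 0 hPpos
  have hlast := hP1 (P.length - 1) (by omega)
  rw [add_zero] at h0
  have hshift := height_eq (m := m) (i := x.length) (j := x.length + C.length) (by omega) (by omega)
    (by omega)
  have hsum : x.length + (x.length + R.length - 1) = 2 * m ∨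
      x.length + (x.length + R.length - 1) = 4 * m + 1 ∨
      x.length + (x.length + R.length - 1) = 6 * m + 2 := by
    by_cases hl : P.length = 1
    · have hbetween : ∀ u, x.length < u → u < x.length + C.length →
          height m x.length ≠ height m u := by
        intro u hu1 hu2 he
        obtain ⟨u, rfl⟩ := Nat.exists_eq_add_of_lt hu1
        have hPu : P = [R[u + 1]'(by omega)] := by
          refine List.ext_getElem (by simpa using hl) fun i h1 h2 => ?_
          have hi0 : i = 0 := by omega
          subst hi0
          rw [h0, he]
          simp [hRf (u + 1) (by omega), add_assoc]
        have := hint (R.take (u + 1)) (R.drop (u + 1 + 1)) (by rw [hPu]; simp)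
        have h5 := congrArg List.length (this.resolve_left fun h => by
          have := congrArg List.length h
          simp only [List.length_take, List.length_nil] at this
          omega)
        simp only [List.length_drop, List.length_nil] at h5
        omega
      have b1 := hbetween (2 * m - x.length)
      have b2 := hbetween (4 * m + 1 - x.length)
      rcases lt_trichotomy x.length m with h | h | h
      · have := height_reflect (m := m) (i := x.length) (j := 2 * m - x.length) (by omega)
        omega
      · omega
      · have h6 : x.length + C.length < 4 * m + 2 := by omega
        have := height_reflect (m := m) (i := x.length) (j := 4 * m + 1 - x.length)
        omega
    · have hne1 := height_eq (m := m) (i := x.length) (j := x.length + (P.length - 1)) (by omega)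
        (by omega) (by omega)
      have h1 := hP1 1 (by omega)
      have h2 : P[1] = k + height m (x.length + C.length + 1) := by
        rw [add_assoc, ← hRf (C.length + 1) (by omega)]
        simp [← hC]
      have := height_eq (m := m) (i := x.length + 1) (j := x.length + C.length + 1) (by omega)
        (by omega) (by omega)
      omega
  refine List.ext_getElem (by simp) fun i h1 h2 => ?_
  rw [List.getElem_reverse, hRf _ h2, hRf _ (by omega)]
  rw [height_reflect (m := m) (i := x.length + (R.length - 1 - i)) (j := x.length + i) (by omega)]

/-- For K = [k], which is `mountain k 0`, the language is its own image language, so the decoding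
argument closes as an induction on length. -/
theorem returnPalindrome_lang (hk : 2 ≤ k) {R : List ℕ} (hR : R ∈ lang k) :
    ReturnPalindrome R := by
  induction hn : R.length using Nat.strong_induction_on generalizing R with
  | _ n ih =>
  subst hn
  refine (marker_singleton hk).returnPalindrome_image ?_ (fun W hW hlt => ih _ hlt hW rfl)
    (lang_eq_imageLang hk ▸ hR)
  rw [← mountain_zero]
  exact palindromicReturns_mountain k 0

theorem palindromicReturns_imageLang (hk : 2 ≤ k) (m : ℕ) {z : List ℕ}
    (hz : z ∈ imageLang k (mountain k m)) : PalindromicReturns z := fun _ hR =>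
  (marker_mountain hk m).returnPalindrome_image (palindromicReturns_mountain k m)
    (fun _ hW _ => returnPalindrome_lang hk hW) (mem_imageLang_of_infix hz hR)

end Returns

/-! ### Decoding repetitions -/

section Descent

variable {k : ℕ} {K : List ℕ}

/-- The weight of a word: the sum of the weights of its letters. -/
def weight (ω : ℕ → ℕ) (w : List ℕ) : ℕ :=
  (w.map ω).sum

@[simp] theorem weight_nil (ω : ℕ → ℕ) : weight ω [] = 0 := rfl

@[simp] theorem weight_cons (ω : ℕ → ℕ) (a : ℕ) (w : List ℕ) :
    weight ω (a :: w) = ω a + weight ω w := by simp [weight]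

@[simp] theorem weight_append (ω : ℕ → ℕ) (v w : List ℕ) :
    weight ω (v ++ w) = weight ω v + weight ω w := by simp [weight]

@[simp] theorem weight_reverse (ω : ℕ → ℕ) (w : List ℕ) :
    weight ω w.reverse = weight ω w := by simp [weight, List.sum_reverse]

theorem weight_one (w : List ℕ) : weight (fun _ => 1) w = w.length := by simp [weight]

theorem weight_le_of_infix (ω : ℕ → ℕ) {v w : List ℕ} (h : v <:+: w) :
    weight ω v ≤ weight ω w := by
  obtain ⟨x, y, rfl⟩ := h
  simp only [weight_append]
  omega

theorem Marker.weight_expand_reverse (hK : Marker k K) (ω : ℕ → ℕ) (w : List ℕ) :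
    weight ω (expand k K w.reverse) = weight ω (expand k K w) := by
  have := congrArg (weight ω) (hK.reverse_expand w)
  simp only [weight_reverse, weight_append] at this
  omega

theorem weight_inner_le (ω : ℕ → ℕ) {a c : ℕ} (ha : k ≤ a + 1) (hac : a ≤ c) :
    weight ω (inner k K a) ≤ weight ω (inner k K c) := by
  unfold inner
  split_ifs <;> first | omega | simp

/-- Between the letters `k - 1` and `k` there is a long word. -/
theorem Marker.weight_iterate_le (hK : Marker k K) (ω : ℕ → ℕ) {a c : ℕ} {Y : List ℕ}
    (h : a :: (Y ++ [c]) ∈ lang k) (hac : a ≠ c) (ha : k ≤ a + 1) (hc : k ≤ c + 1) :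
    weight ω (expand k K ((expand k [k])^[k - 1] [0])) ≤ weight ω (expand k K (Y ++ [c])) := by
  have hk := hK.two_le
  have hm := le_of_mem_lang hk h
  have hak := hm a (by simp)
  have hck := hm c (by simp)
  rcases lt_or_gt_of_ne hac with hlt | hlt
  · have ha' : a = k - 1 := by omega
    have h' := reverse_mem_lang hk h
    have h1 := iterate_suffix (y := Y.reverse) (i := k - 1) (a := c) hk (by omega) (by omega)
      (by simpa [ha'] using h')
    have h2 := weight_le_of_infix ω (expand_infix (k := k) (K := K) h1.isInfix)
    refine h2.trans ?_
    have h3 := weight_inner_le (K := K) ω ha hlt.le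
    rw [← ha', expand_append, expand_append, weight_append, weight_append,
      hK.weight_expand_reverse]
    simpa using h3
  · have hc' : c = k - 1 := by omega
    subst hc'
    exact weight_le_of_infix ω (expand_infix (iterate_suffix hk (by omega) hlt h).isInfix)

theorem Marker.weight_iterate_le' (hK : Marker k K) (ω : ℕ → ℕ) {a c : ℕ} {Y : List ℕ}
    (h : a :: (Y ++ [c]) ∈ lang k) (hac : a ≠ c) (ha : k ≤ a + 1) (hc : k ≤ c + 1) :
    weight ω (expand k K ((expand k [k])^[k - 1] [0])) ≤ weight ω (expand k K (a :: Y)) := by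
  have := hK.weight_iterate_le ω (Y := Y.reverse) (a := c) (c := a)
    (by simpa using reverse_mem_lang hK.two_le h) hac.symm hc ha
  rwa [← List.reverse_cons, hK.weight_expand_reverse] at this

/-- The two letters must be k - 1 and k, with inner words `K` and `K ++ K`, so what they share fits
in one `K`. -/
theorem Marker.weight_common_prefix (hK : Marker k K) (ω : ℕ → ℕ) {t : List ℕ} {b c : ℕ}
    (hbk : b ≤ k) (hck : c ≤ k) (hbc : b ≠ c) (hb : t <+: inner k K b) (hc : t <+: inner k K c)
    (ht : t ≠ []) : k ≤ b + 1 ∧ k ≤ c + 1 ∧ weight ω t ≤ weight ω K := by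
  obtain ⟨x, t', rfl⟩ := List.exists_cons_of_ne_nil ht
  have h := hK.le_of_mem_inner (x := x) hbc (hb.subset (by simp)) (hc.subset (by simp))
  refine ⟨h.1, h.2, ?_⟩
  have key : ∀ {e}, e + 1 = k → x :: t' <+: inner k K e → weight ω (x :: t') ≤ weight ω K := by
    intro e he h
    rw [inner, if_neg (by omega), if_pos (by omega)] at h
    exact weight_le_of_infix ω h.isInfix
  by_cases hb1 : b + 1 = k
  · exact key hb1 hb
  · exact key (by omega) hc

theorem mem_of_mem_period {α : Type*} {v y : List α} (hv : v ≠ []) (h : y <+: v ++ y) {x : α}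
    (hx : x ∈ y) : x ∈ v := by
  induction hn : y.length using Nat.strong_induction_on generalizing y with
  | _ n ih =>
  subst hn
  rcases List.prefix_or_prefix_of_prefix h (List.prefix_append v y) with h1 | ⟨y2, rfl⟩
  · exact h1.subset hx
  · rw [List.prefix_append_right_inj] at h
    rcases List.mem_append.1 hx with h2 | h2
    · exact h2
    · have := List.length_pos_of_ne_nil hv
      exact ih y2.length (by simp; omega) h h2 rfl

/-- A repetition in the image which contains `0` comes from a repetition in the preimage. -/
theorem Marker.descent (hK : Marker k K) {v y : List ℕ} (hv : v ≠ [])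
    (hz : v ++ y ∈ imageLang k K) (hper : y <+: v ++ y) (hlen : v.length ≤ y.length)
    (h0 : 0 ∈ v ++ y) :
    ∃ v' y', v' ≠ [] ∧ v' ++ y' ∈ lang k ∧ y' <+: v' ++ y' ∧
      (∀ ω, weight ω (expand k K v') = weight ω v) ∧
      ((v'.length ≤ y'.length ∧
        ∀ ω, weight ω (v ++ y) ≤ weight ω (expand k K (v' ++ y')) + ω 0) ∨
      ∀ ω, weight ω (v ++ y) ≤ weight ω (expand k K (v' ++ y')) + ω 0 + 2 * weight ω K ∧
        weight ω (expand k K ((expand k [k])^[k - 1] [0])) ≤ weight ω v) := by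
  obtain ⟨s, V, t, a, b, hzeq, hs, ht, hsa, htb, hC⟩ := hK.parse hz h0
  have hm := le_of_mem_lang hK.two_le hC
  have h0v : 0 ∈ v := by
    rcases List.mem_append.1 h0 with h | h
    · exact h
    · exact mem_of_mem_period hv hper h
  obtain ⟨y2, hy2⟩ : v <+: y :=
    List.prefix_of_prefix_length_le (List.prefix_append _ _) hper hlen
  obtain ⟨s', v1, hv1, hs'⟩ := List.eq_append_cons_of_mem h0v
  have h1 : ∀ (W t : List ℕ), ∃ r, expand k K W ++ 0 :: t = 0 :: r := fun W t => by
    rcases expand_eq_nil_or (k := k) (K := K) W with h | ⟨r', h⟩ <;> simp [h]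
  obtain ⟨r, hr⟩ := h1 V t
  have e1 : s' ++ 0 :: (v1 ++ y) = s ++ 0 :: r := by
    rw [← hr, ← List.append_assoc s, ← hzeq, hv1]; simp
  obtain ⟨rfl, e2⟩ := cons_zero_cancel hs' hs e1
  -- `y` starts with `s' 0` as well
  have hy3 : y = s' ++ 0 :: (v1 ++ y2) := by rw [← hy2, hv1]; simp
  obtain ⟨q, hq⟩ := htb
  have e3 : expand k K (V ++ [b]) = (0 :: (v1 ++ s')) ++ 0 :: (v1 ++ y2 ++ q) := by
    rw [expand_append, expand_cons, ← hq]
    have : expand k K V ++ 0 :: t = 0 :: (v1 ++ s') ++ 0 :: (v1 ++ y2) := by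
      rw [hr, ← e2, hy3]; simp
    have h2 : expand k K V ++ (0 :: (t ++ q ++ expand k K [])) =
      (expand k K V ++ 0 :: t) ++ q := by simp
    rw [h2, this]
    simp
  -- The conjugate `0 v1 s'` of `v` is an exact image; `W1` is the decoded period.
  obtain ⟨W1, c0, W2, hW, hp, -⟩ := hK.zero_split e3
  obtain ⟨V1, c, hV1⟩ := (List.eq_nil_or_concat' W1).resolve_left (by rintro rfl; simp at hp)
  obtain ⟨V2, hV2⟩ : ∃ V2, V = W1 ++ V2 := by
    have h2 : W1 <+: V ++ [b] := ⟨_, hW.symm⟩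
    have h3 := congrArg List.length hW
    simp only [List.length_append, List.length_cons, List.length_nil] at h3
    obtain ⟨V2, hV2⟩ := List.prefix_of_prefix_length_le h2 (List.prefix_append V [b]) (by omega)
    exact ⟨V2, hV2.symm⟩
  have hyeq : y = s' ++ expand k K V2 ++ 0 :: t := by
    have h2 : expand k K W1 ++ (expand k K V2 ++ 0 :: t) = expand k K W1 ++ 0 :: (v1 ++ y2) := by
      rw [← hp, ← List.append_assoc, hp, ← expand_append, ← hV2, hr, ← e2, hy3, ← hp]
      simp
    rw [hy3, ← List.append_cancel_left h2]
    simp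
  have hVk : ∀ x ∈ V, x ≤ k := fun x hx => hm x (by simp [hx])
  obtain ⟨-, c1, hc1, htc1⟩ := hK.prefix_parse (Y := V2) hs hs ht ⟨q, hq⟩
    (fun x hx => hVk x (by rw [hV2]; simp [hx])) (fun x hx => hm x (List.mem_cons_of_mem _ hx))
    (by rw [← hyeq, ← hzeq]; exact hper)
  have hW1len : W1.length = V1.length + 1 := by rw [hV1]; simp
  have hc1V : V2 ++ [c1] <+: W1 ++ V2 := by
    rw [← hV2]
    refine List.prefix_of_prefix_length_le hc1 (List.prefix_append _ _) ?_
    rw [hV2]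
    simp only [List.length_append, List.length_singleton]
    omega
  have hV2V : V2 <+: W1 ++ V2 := (List.prefix_append _ _).trans hc1V
  have hsc : s' <:+ inner k K c := hK.suffix_inner hs (W := V1) ⟨0 :: v1, by
    rw [← hV1, ← hp]; simp⟩
  have hwv : ∀ ω, weight ω (expand k K W1) = weight ω v := fun ω => by
    rw [← hp, hv1]
    simp only [weight_append, weight_cons]
    omega
  have hwz : ∀ ω, weight ω (v ++ y) =
      weight ω s' + weight ω (expand k K (W1 ++ V2)) + ω 0 + weight ω t := fun ω => by
    rw [hzeq, hV2, weight_append, weight_append, weight_cons]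
    omega
  have hck : c ≤ k := hVk c (by rw [hV2, hV1]; simp)
  have hc1k : c1 ≤ k := hVk c1 (by rw [hV2]; exact hc1V.subset (by simp))
  -- Right end: if `b` is the letter `c1` predicted by the period, the decoded repetition is
  -- prolonged by `b`. Otherwise, unless `t` is empty, `b` and `c1` are k - 1 and k, exactly one
  -- period apart, which makes `v` long.
  have hright : ∃ y1, W1 ++ y1 <+: V ++ [b] ∧ y1 <+: W1 ++ y1 ∧
      ((∀ ω, weight ω (expand k K (W1 ++ V2)) + ω 0 + weight ω t ≤
        weight ω (expand k K (W1 ++ y1)) + ω 0) ∨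
      ∀ ω, weight ω (expand k K (W1 ++ V2)) + ω 0 + weight ω t ≤
        weight ω (expand k K (W1 ++ y1)) + ω 0 + weight ω K ∧
        weight ω (expand k K ((expand k [k])^[k - 1] [0])) ≤ weight ω v) := by
    by_cases hb : b = c1
    · subst hb
      refine ⟨V2 ++ [b], by rw [hV2]; simp, hc1V.trans ⟨[b], by simp⟩, Or.inl fun ω => ?_⟩
      have := weight_le_of_infix ω htc1.isInfix
      simp only [expand_append, weight_append, expand_cons, weight_cons]
      omega
    · refine ⟨V2, by rw [hV2]; simp, hV2V, ?_⟩
      by_cases htn : t = []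
      · exact Or.inl fun ω => by simp [htn]
      · refine Or.inr fun ω => ?_
        obtain ⟨hb1, hb2, hb3⟩ := hK.weight_common_prefix ω (hm b (by simp)) hc1k hb ⟨q, hq⟩
          htc1 htn
        refine ⟨by omega, ?_⟩
        obtain ⟨V3, hV3⟩ := hc1V
        have hmem : c1 :: (V3 ++ [b]) ∈ lang k :=
          mem_lang_of_infix hC ⟨a :: V2, [], by rw [hV2, ← hV3]; simp⟩
        have h4 := hK.weight_iterate_le' ω hmem (Ne.symm hb) hb2 hb1
        have h5 := congrArg (fun w => weight ω (expand k K w)) hV3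
        simp only [expand_append, weight_append, expand_cons, weight_cons, expand_nil,
          weight_nil, add_zero] at h5 h4
        have := hwv ω
        omega
  obtain ⟨y1, hy1, hy1', hright⟩ := hright
  -- Left end, likewise; prolonging by `a` replaces the period word `V1 a` by its conjugate `a V1`.
  have hleft : ∃ v' y', v' ≠ [] ∧ v' ++ y' ∈ lang k ∧ y' <+: v' ++ y' ∧
      (∀ ω, weight ω (expand k K v') = weight ω v) ∧
      ((∀ ω, weight ω s' + weight ω (expand k K (W1 ++ y1)) ≤
        weight ω (expand k K (v' ++ y'))) ∨
      ∀ ω, weight ω s' + weight ω (expand k K (W1 ++ y1)) ≤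
        weight ω (expand k K (v' ++ y')) + weight ω K ∧
        weight ω (expand k K ((expand k [k])^[k - 1] [0])) ≤ weight ω v) := by
    have hinf : a :: (W1 ++ y1) <+: a :: (V ++ [b]) := by
      rw [List.cons_prefix_cons]; exact ⟨rfl, hy1⟩
    have hW1n : W1 ≠ [] := by rw [hV1]; simp
    by_cases hac : a = c
    · subst hac
      refine ⟨a :: V1, a :: y1, by simp, ?_, ?_, fun ω => ?_, Or.inl fun ω => ?_⟩
      · refine mem_lang_of_infix hC (List.IsInfix.trans ?_ hinf.isInfix)
        rw [hV1]; simp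
      · rw [List.cons_append, List.cons_prefix_cons]
        refine ⟨rfl, ?_⟩
        rw [hV1] at hy1'
        simpa using hy1'
      · rw [← hwv, hV1]
        simp only [expand_append, weight_append, expand_cons, weight_cons, expand_nil, weight_nil]
        omega
      · have := weight_le_of_infix ω hsa.isInfix
        rw [hV1]
        simp only [expand_append, weight_append, expand_cons, weight_cons, expand_nil, weight_nil]
        omega
    · refine ⟨W1, y1, hW1n, ?_, hy1', hwv, ?_⟩
      · exact mem_lang_of_infix hC (List.IsInfix.trans ⟨[a], [], by simp⟩ hinf.isInfix)
      · by_cases hsn : s' = []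
        · exact Or.inl fun ω => by simp [hsn]
        · refine Or.inr fun ω => ?_
          rw [← List.reverse_prefix, hK.reverse_inner] at hsa hsc
          obtain ⟨ha1, ha2, ha3⟩ := hK.weight_common_prefix ω (hm a (by simp)) hck hac hsa hsc
            (by simpa using hsn)
          rw [weight_reverse] at ha3
          refine ⟨by omega, ?_⟩
          rw [← hwv, hV1]
          refine hK.weight_iterate_le ω ?_ hac ha1 ha2
          exact mem_lang_of_infix hC (List.IsInfix.trans ⟨[], y1, by rw [hV1]; simp⟩ hinf.isInfix)
  obtain ⟨v', y', hv', hmem', hper', hwv', hleft⟩ := hleft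
  refine ⟨v', y', hv', hmem', hper', hwv', ?_⟩
  rcases hleft with hl | hl
  · rcases hright with hrt | hrt
    · have hall : ∀ ω, weight ω (v ++ y) ≤ weight ω (expand k K (v' ++ y')) + ω 0 := fun ω => by
        have := hl ω
        have := hrt ω
        have := hwz ω
        omega
      refine Or.inl ⟨?_, hall⟩
      -- If `y'` were shorter than `v'`, the image of the decoded word would miss two full periods
      -- by at least 2, more than the single 0 that was lost.
      by_contra hcon
      obtain ⟨g, hg⟩ := List.prefix_of_prefix_length_le hper' (List.prefix_append v' y')
        (by omega)
      have h2 := hall fun _ => 1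
      have h3 := hwv' fun _ => 1
      have h4 := congrArg (fun w => (expand k K w).length) hg
      have h5 := length_expand_ge hK g
      have h6 := congrArg List.length hg
      simp only [weight_one, expand_append, List.length_append] at h2 h3 h4 h6
      omega
    · refine Or.inr fun ω => ⟨?_, (hrt ω).2⟩
      have := hl ω
      have := (hrt ω).1
      have := hwz ω
      omega
  · refine Or.inr fun ω => ⟨?_, (hl ω).2⟩
    have := (hl ω).1
    have := hwz ω
    rcases hright with hrt | hrt
    · have := hrt ω
      omega
    · have := (hrt ω).1
      omega

end Descent

/-! ### Growth of the images of letters -/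

section Weights

/-- The lengths of the images of the letters under the iterates of `expand k [k]`, when the letter
`k` has length `B` and the other ones have length `1`. -/
def letterWeight (k B : ℕ) : ℕ → ℕ → ℕ
  | 0, a => if a < k then 1 else B
  | m + 1, a => letterWeight k B m 0 +
      if a < k then letterWeight k B m (a + 1) else 2 * letterWeight k B m k

variable {k B : ℕ}

theorem weight_expand (k B m : ℕ) (w : List ℕ) :
    weight (letterWeight k B m) (expand k [k] w) = weight (letterWeight k B (m + 1)) w := by
  induction w with
  | nil => rfl
  | cons a w ih =>
    rw [expand_cons, weight_cons, weight_append, weight_cons, ih, letterWeight]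
    unfold inner
    split_ifs with h1 h2 h3
    · simp; omega
    · omega
    · have : a + 1 = k := by omega
      simp [this]; omega
    · simp; omega

theorem weight_expand_iterate (k B m n : ℕ) (w : List ℕ) :
    weight (letterWeight k B m) ((expand k [k])^[n] w) =
      weight (letterWeight k B (m + n)) w := by
  induction n generalizing m with
  | zero => rfl
  | succ n ih =>
    rw [Function.iterate_succ_apply', weight_expand, ih]
    congr 2
    omega

theorem length_expand (hk : 2 ≤ k) {K : List ℕ} (w : List ℕ) :
    (expand k K w).length = weight (letterWeight k K.length 1) w := by
  induction w with
  | nil => rfl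
  | cons a w ih =>
    rw [expand_cons, weight_cons, List.length_cons, List.length_append, ih]
    simp only [letterWeight, inner]
    split_ifs <;> first | omega | (simp; omega)

theorem letterWeight_succ_self (k B m : ℕ) :
    letterWeight k B (m + 1) k = letterWeight k B m 0 + 2 * letterWeight k B m k := by
  simp [letterWeight]

theorem letterWeight_eq_sum (k B n : ℕ) {i c : ℕ} (h : c + i = k) :
    letterWeight k B (n + i) c =
      ∑ l ∈ Finset.range i, letterWeight k B (n + l) 0 + letterWeight k B n k := by
  induction i generalizing c with
  | zero => simp [← h]
  | succ i ih =>
    rw [← add_assoc, letterWeight, if_pos (by omega), ih (c := c + 1) (by omega),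
      Finset.sum_range_succ]
    ring

/-- Difference of two consecutive instances of `letterWeight_eq_sum`. -/
theorem letterWeight_add_succ (k B n : ℕ) :
    letterWeight k B (n + k + 1) 0 = 2 * letterWeight k B (n + k) 0 + letterWeight k B n k := by
  have h1 := letterWeight_eq_sum k B n (zero_add k)
  have h2 := letterWeight_eq_sum k B (n + 1) (zero_add k)
  have h3 := letterWeight_succ_self k B n
  have h4 := Finset.sum_range_succ (fun l => letterWeight k B (n + l) 0) k
  have h5 := Finset.sum_range_succ' (fun l => letterWeight k B (n + l) 0) k
  have h6 : ∑ l ∈ Finset.range k, letterWeight k B (n + (l + 1)) 0 =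
      ∑ l ∈ Finset.range k, letterWeight k B (n + 1 + l) 0 :=
    Finset.sum_congr rfl fun l _ => by rw [add_comm l 1, add_assoc]
  rw [h6, add_zero] at h5
  have h7 : n + 1 + k = n + k + 1 := by omega
  rw [h7] at h2
  omega

theorem letterWeight_of_lt {n c : ℕ} (h : n + c < k) : letterWeight k B n c = 2 ^ n := by
  induction n generalizing c with
  | zero => simp [letterWeight]; omega
  | succ n ih =>
    rw [letterWeight, if_pos (by omega), ih (by omega), ih (by omega)]
    ring

theorem letterWeight_self_ge (k B n : ℕ) : 2 ^ n * B ≤ letterWeight k B n k := by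
  induction n with
  | zero => simp [letterWeight]
  | succ n ih =>
    rw [letterWeight_succ_self, pow_succ]
    nlinarith

/-- This motivates B = q + 1 with q² = 2^k: the weight of 0 at level k is then exactly qB. -/
theorem letterWeight_k (k B : ℕ) : letterWeight k B k 0 + 1 = 2 ^ k + B := by
  have h1 := letterWeight_eq_sum k B 0 (zero_add k)
  have h2 : ∀ n ∈ Finset.range k, letterWeight k B (0 + n) 0 = 2 ^ n := fun n hn => by
    rw [zero_add]
    exact letterWeight_of_lt (by simpa using hn)
  rw [Finset.sum_congr rfl h2, zero_add] at h1
  have h3 := Nat.geomSum_eq (m := 2) le_rfl k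
  have h4 : letterWeight k B 0 k = B := by simp [letterWeight]
  have h5 : 1 ≤ 2 ^ k := Nat.one_le_two_pow
  rw [h3, h4] at h1
  simp only [Nat.add_one_sub_one, Nat.div_one] at h1
  omega

/-- The letter `0` is light compared to `k`, whose weight in turn is small after `k` more steps. -/
theorem letterWeight_bounds {q : ℕ} (hq : q * q = 2 ^ k) (n : ℕ) :
    q * letterWeight k (q + 1) n 0 ≤ letterWeight k (q + 1) n k ∧
      q * letterWeight k (q + 1) n k ≤ letterWeight k (q + 1) (n + k) 0 := by
  have hk := letterWeight_k k (q + 1)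
  induction n using Nat.strong_induction_on with
  | _ n ih =>
  constructor
  · rcases lt_trichotomy n k with h | h | h
    · rw [letterWeight_of_lt (by omega)]
      have := letterWeight_self_ge k (q + 1) n
      nlinarith
    · subst h
      have h1 := letterWeight_self_ge n (q + 1) n
      have h2 : letterWeight n (q + 1) n 0 = q * q + q := by omega
      rw [h2]
      rw [← hq] at h1
      nlinarith
    · obtain ⟨l, rfl⟩ := Nat.exists_eq_add_of_lt h
      have e : k + l + 1 = l + k + 1 := by omega
      rw [e] at ih ⊢
      rw [letterWeight_add_succ, letterWeight_succ_self]
      have h1 := (ih (l + k) (by omega)).1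
      have h2 := (ih l (by omega)).2
      nlinarith
  · rcases n with _ | n
    · rw [zero_add]
      have h4 : letterWeight k (q + 1) 0 k = q + 1 := by simp [letterWeight]
      have h2 : letterWeight k (q + 1) k 0 = q * q + q := by omega
      rw [h4, h2]
      nlinarith
    · have e : n + 1 + k = n + k + 1 := by omega
      rw [e, letterWeight_add_succ, letterWeight_succ_self]
      have h1 := (ih n (by omega)).1
      have h2 := (ih n (by omega)).2
      nlinarith

end Weights

/-! ### Bounding the exponents -/

section Exponents

variable {k : ℕ}

/-- Here a and b are the weights of 0 and k, b' is that of k one level higher, and p is the period.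
The loss qa ≤ b is paid by the growth of p - b as b' drops to b. -/
theorem bound_step_short {q a b b' p w w' : ℕ} (hab : q * a ≤ b) (hb' : b' = a + 2 * b)
    (hp : b' ≤ p) (hw' : q * w' ≤ 2 * (q * p) + (p - b') + 4 * (2 * p - q * b'))
    (hw : w ≤ w' + a) :
    b ≤ p ∧ q * w ≤ 2 * (q * p) + (p - b) + 4 * (2 * p - q * b) := by
  have h1 : q * w ≤ q * w' + q * a := by rw [← mul_add]; exact Nat.mul_le_mul_left q hw
  have h2 : q * b' = q * a + 2 * (q * b) := by rw [hb']; ring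
  omega

/-- As qb ≤ p, the truncated difference 2p - qb exceeds its value for b' by at least qb; four times
this covers the loss q(a + 2b) ≤ 3qb. -/
theorem bound_step_long {q a b b' p w w' : ℕ} (hq : 1 ≤ q) (hab : q * a ≤ b)
    (hb' : b' = a + 2 * b) (hp : q * b ≤ p)
    (hw' : w' ≤ 2 * p ∨
      (b' ≤ p ∧ q * w' ≤ 2 * (q * p) + (p - b') + 4 * (2 * p - q * b')))
    (hw : w ≤ w' + a + 2 * b) :
    b ≤ p ∧ q * w ≤ 2 * (q * p) + (p - b) + 4 * (2 * p - q * b) := by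
  have h1 : q * w ≤ q * w' + q * a + 2 * (q * b) := by
    have := Nat.mul_le_mul_left q hw
    linarith
  have h2 : q * b' = q * a + 2 * (q * b) := by rw [hb']; ring
  have h3 : b ≤ q * b := Nat.le_mul_of_pos_left b hq
  rcases hw' with hw' | ⟨hbp, hw'⟩
  · have h4 : q * w' ≤ 2 * (q * p) := by
      have := Nat.mul_le_mul_left q hw'
      linarith
    omega
  · omega

/-- Decoding trades level m for level m + 1, so the induction on `|v|` runs over all levels at once.
The first conjunct makes the first subtraction exact; the last one is truncated to 0 until the
period is long. The base case is the square k k. -/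
theorem repetition_bound_lang (hk : 2 ≤ k) {q : ℕ} (hq1 : 1 ≤ q) (hq : q * q = 2 ^ k)
    {v y : List ℕ} (hv : v ≠ []) (hz : v ++ y ∈ lang k) (hper : y <+: v ++ y)
    (hlen : v.length ≤ y.length) (m : ℕ) :
    letterWeight k (q + 1) m k ≤ weight (letterWeight k (q + 1) m) v ∧
      q * weight (letterWeight k (q + 1) m) (v ++ y) ≤
        2 * (q * weight (letterWeight k (q + 1) m) v) +
          (weight (letterWeight k (q + 1) m) v - letterWeight k (q + 1) m k) +
          4 * (2 * weight (letterWeight k (q + 1) m) v - q * letterWeight k (q + 1) m k) := by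
  induction hn : v.length using Nat.strong_induction_on generalizing v y m with
  | _ n ih =>
  subst hn
  have hK := marker_singleton hk
  have hvpos := List.length_pos_of_ne_nil hv
  have hb := letterWeight_bounds hq m
  have hsucc := letterWeight_succ_self k (q + 1) m
  rw [lang_eq_imageLang hk] at hz
  by_cases h0 : 0 ∈ v ++ y
  · obtain ⟨v', y', hv', hmem, hper', hwv, hcase⟩ := hK.descent hv hz hper hlen h0
    have hw1 := hwv (letterWeight k (q + 1) m)
    rw [weight_expand] at hw1
    have hlt : v'.length < v.length := by
      have h1 := hwv fun _ => 1
      rw [weight_one, weight_one] at h1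
      have := length_expand_ge hK v'
      have := List.length_pos_of_ne_nil hv'
      omega
    rcases hcase with ⟨hl, hw⟩ | hw
    · have hi := ih _ hlt hv' hmem hper' hl (m + 1) rfl
      have hw' := hw (letterWeight k (q + 1) m)
      rw [weight_expand] at hw'
      rw [hw1] at hi
      exact bound_step_short hb.1 hsucc hi.1 hi.2 hw'
    · obtain ⟨hw', hlong⟩ := hw (letterWeight k (q + 1) m)
      rw [weight_expand] at hw'
      rw [← Function.iterate_succ_apply' (expand k [k]), weight_expand_iterate,
        Nat.succ_eq_add_one, Nat.sub_add_cancel (by omega)] at hlong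
      simp only [weight_cons, weight_nil, add_zero] at hlong hw'
      refine bound_step_long hq1 hb.1 hsucc (hb.2.trans hlong) ?_ hw'
      by_cases hl : v'.length ≤ y'.length
      · have hi := ih _ hlt hv' hmem hper' hl (m + 1) rfl
        rw [hw1] at hi
        exact Or.inr hi
      · refine Or.inl ?_
        have := weight_le_of_infix (letterWeight k (q + 1) (m + 1))
          (List.prefix_of_prefix_length_le hper' (List.prefix_append v' y') (by omega)).isInfix
        rw [weight_append]
        omega
  · obtain ⟨a, ha⟩ := infix_inner hz h0
    have hl := ha.length_le
    rw [List.length_append] at hl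
    have ha2 : v ++ y = [k, k] := by
      unfold inner at ha hl
      split_ifs at ha hl
      · simp at hl; omega
      · simp at hl; omega
      · exact ha.eq_of_length_le (by simp; omega)
    have hl2 := congrArg List.length ha2
    simp only [List.length_append, List.length_cons, List.length_nil] at hl2
    obtain ⟨x, rfl⟩ := List.length_eq_one_iff.1 (show v.length = 1 by omega)
    obtain ⟨x', rfl⟩ := List.length_eq_one_iff.1 (show y.length = 1 by simp at hl2 ⊢; omega)
    simp only [List.singleton_append, List.cons.injEq, and_true] at ha2
    obtain ⟨rfl, rfl⟩ := ha2
    simp only [List.singleton_append, weight_cons, weight_nil, add_zero, le_refl, true_and]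
    have : q * (letterWeight x' (q + 1) m x' + letterWeight x' (q + 1) m x') =
      2 * (q * letterWeight x' (q + 1) m x') := by ring
    omega

/-- More than two periods would match two consecutive positions with their shifts, forcing period 2m
+ 1, but only 4m + 2 letters are available. -/
theorem repetition_mountain {m : ℕ} {v y : List ℕ} (hv : v ≠ [])
    (hz : v ++ y <:+: mountain k m ++ mountain k m) (hper : y <+: v ++ y) :
    (v ++ y).length ≤ 2 * v.length := by
  by_contra hcon
  obtain ⟨x, x', hx⟩ := hz
  have hvpos := List.length_pos_of_ne_nil hv
  have hlen := congrArg List.length hx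
  obtain ⟨r, hr⟩ := hper
  simp only [List.length_append, length_mountain] at hlen hcon
  have hzf := getElem_of_infix_mountain hx
  have hsh : ∀ t, t < y.length →
      height m (x.length + t) = height m (x.length + v.length + t) := by
    intro t ht
    have h1 := hzf t (by simp; omega)
    have h2 := hzf (v.length + t) (by simp; omega)
    have h3 : (v ++ y)[v.length + t]'(by simp; omega) = y[t] := by simp
    have h4 : (v ++ y)[t]'(by simp; omega) = y[t] := by
      simp only [← hr]
      rw [List.getElem_append_left ht]
    rw [add_assoc]
    omega
  have h1 := height_eq (m := m) (by omega) (by omega) (hsh 0 (by omega))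
  have h2 := height_eq (m := m) (by omega) (by omega) (hsh 1 (by omega))
  omega

/-- The repetitions in the image have exponent at most `2 + 9 / q`. -/
theorem repetition_bound (hk : 2 ≤ k) {q m : ℕ} (hq1 : 1 ≤ q) (hq : q * q = 2 ^ k)
    (hm : 2 * m = q) {v y : List ℕ} (hv : v ≠ []) (hz : v ++ y ∈ imageLang k (mountain k m))
    (hper : y <+: v ++ y) : q * (v ++ y).length ≤ (2 * q + 9) * v.length := by
  have hK := marker_mountain hk m
  by_cases hlen : v.length ≤ y.length
  swap
  · have h1 : (v ++ y).length ≤ 2 * v.length := by simp; omega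
    nlinarith
  have hKl : (mountain k m).length = q + 1 := by rw [length_mountain, hm]
  have hb := letterWeight_bounds hq 0
  have hsucc := letterWeight_succ_self k (q + 1) 0
  have h00 : letterWeight k (q + 1) 0 0 = 1 := by simp [letterWeight]; omega
  have h0k : letterWeight k (q + 1) 0 k = q + 1 := by simp [letterWeight]
  rw [h00, h0k] at hb hsucc
  rw [zero_add] at hb hsucc
  -- The two subtracted terms are at most `|v|` and `8|v|`, whence the constant 9.
  suffices q + 1 ≤ v.length ∧ q * (v ++ y).length ≤
      2 * (q * v.length) + (v.length - (q + 1)) + 4 * (2 * v.length - q * (q + 1)) ∨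
      (v ++ y).length ≤ 2 * v.length by
    rcases this with h | h
    · have : (2 * q + 9) * v.length = 2 * (q * v.length) + 9 * v.length := by ring
      omega
    · nlinarith
  by_cases h0 : 0 ∈ v ++ y
  · refine Or.inl ?_
    obtain ⟨v', y', hv', hmem, hper', hwv, hcase⟩ := hK.descent hv hz hper hlen h0
    have hw1 := hwv fun _ => 1
    rw [weight_one, weight_one, length_expand hk, hKl] at hw1
    rcases hcase with ⟨hl, hw⟩ | hw
    · have hi := repetition_bound_lang hk hq1 hq hv' hmem hper' hl 1
      have hw' := hw fun _ => 1
      rw [weight_one, weight_one, length_expand hk, hKl] at hw'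
      rw [hw1] at hi
      exact bound_step_short hb.1 hsucc hi.1 hi.2 hw'
    · obtain ⟨hw', hlong⟩ := hw fun _ => 1
      rw [weight_one, weight_one, length_expand hk, hKl] at hlong
      rw [weight_one, weight_one, weight_one, length_expand hk, hKl] at hw'
      rw [weight_expand_iterate, show 1 + (k - 1) = k by omega] at hlong
      simp only [weight_cons, weight_nil, add_zero] at hlong
      refine bound_step_long hq1 hb.1 hsucc (hb.2.trans hlong) ?_ hw'
      by_cases hl : v'.length ≤ y'.length
      · have hi := repetition_bound_lang hk hq1 hq hv' hmem hper' hl 1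
        rw [hw1] at hi
        exact Or.inr hi
      · refine Or.inl ?_
        have := weight_le_of_infix (letterWeight k (q + 1) 1)
          (List.prefix_of_prefix_length_le hper' (List.prefix_append v' y') (by omega)).isInfix
        rw [weight_append]
        omega
  · obtain ⟨a, ha⟩ := infix_inner hz h0
    refine Or.inr ?_
    by_cases hak : k ≤ a + 1
    · exact repetition_mountain hv (ha.trans (inner_suffix hak).isInfix) hper
    · rw [inner, if_pos (by omega)] at ha
      have := ha.length_le
      have := List.length_pos_of_ne_nil hv
      simp only [List.length_append, List.length_singleton] at *
      omega

end Exponents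

/-! ### The infinite word and the upper bound -/

section Sequence

theorem PalindromicReturns.of_map {α β : Type*} {f : α → β} (hf : Function.Injective f)
    {w : List α} (h : PalindromicReturns (w.map f)) : PalindromicReturns w := by
  intro R hR P hPn hP hpre hsuf hne hint
  have hinj := List.map_injective_iff.2 hf
  refine hinj ?_
  rw [List.map_reverse]
  refine h _ (hR.map f) (P.map f) (by simpa using hPn) (by rw [← List.map_reverse, hP])
    (hpre.map f) (hsuf.map f) (fun he => hne (hinj he)) fun x y he => ?_
  obtain ⟨R1, y', hR', h1, rfl⟩ := List.map_eq_append_iff.1 he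
  obtain ⟨x', P', rfl, rfl, h2⟩ := List.map_eq_append_iff.1 h1
  rw [hinj h2] at hR'
  simpa using hint x' y' hR'

variable {k : ℕ} {K : List ℕ}

theorem iterate_prefix_succ (hk : 2 ≤ k) (n : ℕ) :
    (expand k [k])^[n + 1] [0] = (expand k [k])^[n] [0] ++ (expand k [k])^[n] [1] := by
  rw [Function.iterate_succ_apply, ← expand_iterate_append]
  congr 1
  simp [inner_zero hk]

/-- The prefixes of the infinite word with language `imageLang k K`. -/
def prefixWord (k : ℕ) (K : List ℕ) (n : ℕ) : List ℕ :=
  expand k K ((expand k [k])^[n] [0])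

theorem prefixWord_prefix (hk : 2 ≤ k) {a b : ℕ} (hab : a ≤ b) :
    prefixWord k K a <+: prefixWord k K b := by
  induction b, hab using Nat.le_induction with
  | base => exact List.prefix_rfl
  | succ n _ ih =>
    refine ih.trans ?_
    rw [prefixWord, prefixWord, iterate_prefix_succ hk, expand_append]
    exact List.prefix_append _ _

theorem lt_length_prefixWord (hK : Marker k K) (n : ℕ) : n < (prefixWord k K n).length := by
  have h1 : n < ((expand k [k])^[n] [0]).length := by
    induction n with
    | zero => simp
    | succ n ih =>
      have := List.length_pos_of_ne_nil
        (expand_iterate_ne_nil (k := k) (K := [k]) n (w := [1]) (by simp))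
      rw [iterate_prefix_succ hK.two_le, List.length_append]
      omega
  have := length_expand_ge hK ((expand k [k])^[n] [0])
  unfold prefixWord
  omega

/-- The infinite word with language `imageLang k K`. -/
def fixedSeq (k : ℕ) (K : List ℕ) (i : ℕ) : ℕ :=
  -- For a `Marker` the default is never used: the prefix of index `i` has more than `i` letters.
  (prefixWord k K i).getD i 0

theorem fixedSeq_eq (hK : Marker k K) {i n : ℕ} (hi : i < (prefixWord k K n).length) :
    fixedSeq k K i = (prefixWord k K n)[i] := by
  rw [fixedSeq, List.getD_eq_getElem _ _ (lt_length_prefixWord hK i)]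
  rcases le_total i n with h | h
  · exact (prefixWord_prefix hK.two_le h).getElem _
  · exact ((prefixWord_prefix hK.two_le h).getElem _).symm

theorem block_fixedSeq_mem (hK : Marker k K) (j n : ℕ) :
    block (fixedSeq k K) j n ∈ imageLang k K := by
  have hlt := lt_length_prefixWord hK (j + n)
  refine ⟨_, ⟨j + n, List.infix_rfl⟩, ?_⟩
  have : block (fixedSeq k K) j n = ((prefixWord k K (j + n)).drop j).take n := by
    refine List.ext_getElem (by simp [block]; omega) fun i h1 h2 => ?_
    simp only [block, List.length_ofFn] at h1
    simp only [block, List.getElem_ofFn, List.getElem_take, List.getElem_drop]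
    exact fixedSeq_eq hK _
  rw [this]
  exact (List.take_prefix _ _).isInfix.trans (List.drop_suffix _ _).isInfix

theorem fixedSeq_lt {m : ℕ} (hk : 2 ≤ k) (i : ℕ) : fixedSeq k (mountain k m) i < k + m + 1 := by
  have h1 := block_fixedSeq_mem (marker_mountain hk m) i 1
  obtain ⟨W, -, hW⟩ := h1
  have hmem := hW.subset (show fixedSeq k (mountain k m) i ∈ _ by simp [block])
  rw [expand, List.mem_flatMap] at hmem
  obtain ⟨a, -, ha⟩ := hmem
  have hm : ∀ x ∈ mountain k m, x < k + m + 1 := fun x hx => by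
    simp only [mountain, List.mem_ofFn] at hx
    obtain ⟨i, rfl⟩ := hx
    omega
  rcases List.mem_cons.1 ha with h | h
  · omega
  · unfold inner at h
    split_ifs at h
    · simp at h; omega
    · exact hm _ h
    · exact hm _ (by simpa using h)

/-- The prefix of `z` whose length is the minimal period of `z`, together with the rest of `z`. -/
theorem exists_root {α : Type*} {z : List α} (hz : z ≠ []) :
    ∃ v y, z = v ++ y ∧ v ≠ [] ∧ y <+: v ++ y ∧ v.length = sInf (rootLengths z) := by
  have hmem := Nat.sInf_mem ⟨_, length_mem_rootLengths hz⟩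
  have hle : sInf (rootLengths z) ≤ z.length := Nat.sInf_le (length_mem_rootLengths hz)
  have hpos := pos_of_mem_rootLengths hmem
  obtain ⟨v, hv, hvl, hvz⟩ := hmem
  generalize sInf (rootLengths z) = r at *
  have hzi : ∀ i (hi : i < z.length), z[i] = omegaPower v hv i := fun i hi => by
    have : z[i] = (block (omegaPower v hv) 0 z.length)[i]'(by simpa [block] using hi) := by
      congr 1
    rw [this]
    simp [block]
  refine ⟨z.take r, z.drop r, by simp, ?_, ?_, by simpa using hle⟩
  · intro h
    have := congrArg List.length h
    simp only [List.length_take, List.length_nil] at this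
    omega
  · rw [List.take_append_drop]
    have : z.drop r = z.take (z.length - r) := by
      refine List.ext_getElem (by simp) fun i h1 h2 => ?_
      rw [List.length_drop] at h1
      rw [List.getElem_drop, List.getElem_take, hzi _ (by omega), hzi _ (by omega)]
      simp only [omegaPower, ← hvl, Nat.add_mod_left]
    rw [this]
    exact List.take_prefix _ _

theorem repetitionThreshold_le {j d : ℕ} (hd : 2 * (j + 1) + 2 ^ j + 1 ≤ d) :
    repetitionThreshold (richClass d) ≤ ((2 + 9 * (1 / 2) ^ (j + 1) : ℝ≥0) : ℝ≥0∞) := by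
  have hk : 2 ≤ 2 * (j + 1) := by omega
  -- With q = 2^(j + 1), these choices give q² = 2^k and |K| = 2m + 1 = q + 1, over k + m + 1
  -- letters.
  set k := 2 * (j + 1) with hkdef
  set m := 2 ^ j with hm
  have hK := marker_mountain hk m
  set u : ℕ → Fin d := fun i =>
    ⟨fixedSeq k (mountain k m) i, (fixedSeq_lt hk i).trans_le hd⟩ with hu
  have hmap : ∀ w ∈ language u, w.map Fin.val ∈ imageLang k (mountain k m) := by
    rintro w ⟨i, n, rfl⟩
    have : (block u i n).map Fin.val = block (fixedSeq k (mountain k m)) i n := by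
      simp only [block, List.map_ofFn]
      rfl
    rw [this]
    exact block_fixedSeq_mem hK i n
  have hrich : u ∈ richClass d := fun w hw =>
    (PalindromicReturns.of_map Fin.val_injective
      (palindromicReturns_imageLang hk m (hmap w hw))).richWord
  refine (iInf₂_le u hrich).trans (iSup₂_le fun z hz => ?_)
  obtain ⟨v, y, hzv, hv, hper, hlen⟩ := exists_root hz.2
  have hbound := repetition_bound (k := k) (q := 2 ^ (j + 1)) (m := m) hk Nat.one_le_two_pow
    (by rw [hkdef, ← pow_add]; congr 1; omega) (by rw [hm, pow_succ]; ring)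
    (v := v.map Fin.val) (y := y.map Fin.val) (by simpa using hv)
    (by rw [← List.map_append, ← hzv]; exact hmap z hz.1)
    (by rw [← List.map_append]; exact hper.map _)
  rw [← List.map_append, ← hzv, List.length_map, List.length_map] at hbound
  have hvpos : (0 : ℝ≥0) < v.length := by exact_mod_cast List.length_pos_of_ne_nil hv
  rw [ENNReal.coe_le_coe, exponent, ← hlen, div_le_iff₀ hvpos]
  have hb : (2 ^ (j + 1) : ℝ≥0) * z.length ≤ (2 * 2 ^ (j + 1) + 9) * v.length := by
    exact_mod_cast hbound
  have hpow : (0 : ℝ≥0) < 2 ^ (j + 1) := by positivity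
  refine le_of_mul_le_mul_left (hb.trans_eq ?_) hpow
  rw [← mul_assoc]
  congr 1
  rw [one_div, inv_pow, mul_add]
  field_simp

end Sequence

end RichSeq

theorem mainTheorem2 :
    Tendsto (fun d : ℕ => RichSeq.repetitionThreshold (RichSeq.richClass d)) atTop
      (𝓝 (2 : ℝ≥0∞)) := by
  refine tendsto_order.2 ⟨fun a ha => Eventually.of_forall fun d =>
    ha.trans_le (RichSeq.two_le_repetitionThreshold d), fun b hb => ?_⟩
  have hlim : Tendsto (fun j : ℕ => ((2 + 9 * (1 / 2) ^ (j + 1) : ℝ≥0) : ℝ≥0∞)) atTop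
      (𝓝 (2 : ℝ≥0∞)) := by
    have h1 : Tendsto (fun j : ℕ => ((1 / 2 : ℝ≥0)) ^ (j + 1)) atTop (𝓝 0) :=
      (tendsto_add_atTop_iff_nat 1).2
        (NNReal.tendsto_pow_atTop_nhds_zero_of_lt_one (by
          rw [div_lt_one (by norm_num)]; norm_num))
    have h2 := (h1.const_mul 9).const_add 2
    rw [mul_zero, add_zero] at h2
    exact ENNReal.tendsto_coe.2 h2
  obtain ⟨j, hj⟩ := (hlim.eventually_lt_const hb).exists
  filter_upwards [eventually_ge_atTop (2 * (j + 1) + 2 ^ j + 1)] with d hd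
  exact (RichSeq.repetitionThreshold_le hd).trans_lt hj
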